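/- **Theorem (role assignment phase).** There is a universal constant $C$, and for every $m$ a constant $K_m$, such that the following holds for every shape $S_F$ in the triangular grid (a non-empty connected union of finitely many edges and triangular faces) with $m$ grid vertices. (For a minimal $S_F$, which may be assumed without loss of generality, $m$ is its base size.) *Elements.* Let $k\in\{1,2,3\}$; if $k>1$, suppose that $S_F$ is unbreakably $k$-symmetric, i.e. has a $k$-fold rotational symmetry $\rho$ whose center is not a grid vertex (for $k=1$ let $\rho$ be the identity). For an integer $\lambda\ge 7$ with $\lambda\equiv 1\pmod 6$, the grid vertices in the scaled copy $S'_F=\lambda S_F$ are partitioned into *elements*: the super-vertices, super-edges and super-triangles, which are the sets of grid vertices in the relative interiors of $\lambda\tau$, for $\tau$ a vertex, edge or face of $S_F$. However, if $k>1$ and $S_F$ contains its center, the element through the center is replaced by $k$ partial elements, permuted cyclically by the symmetry: for $k=2$ the super-edge is cut at its midpoint into two partial super-edges; for $k=3$ the super-triangle is cut, along the three rays from its center parallel to its counterclockwise oriented sides, into three partial super-triangles. There is a selection $R$ of elements, not depending on $\lambda$, such that $R,\rho R,\dots,\rho^{k-1}R$ partition the elements (one symmetric region per Leader). Fix any such $R$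 for each admissible $k$, and let $\mathcal P(\lambda)$ be the total number of grid vertices in the elements of $R$. *Claim.* There is a deterministic algorithm for particles with finitely many internal states and messages, depending only on $S_F$ and on these selections, such that the following holds for each admissible $k$ and each $n=kN$ with $n\ge C m^3$. Let $\lambda$ be the first of the numbers $7,13,19,\dots$ with $\mathcal P(\lambda)\ge N$, and let $d=\mathcal P(\lambda)-N$. Let a system of $n$ contracted particles form $k$ straight line segments (*directrices*) of $N$ particles each, each starting at a Leader, such that the Leaders are pairwise adjacent and, if $k>1$, each segment has a second Leader on its extension beyond its own Leader. Initially there are no pending messages, each Leader knows $k$ and the port toward its segment, all other particles are in one common state, and all variables Role are Undefined. Then, for all port labelings and all fair asynchronous schedules, no particle ever moves, and after at most $K_m n^2$ rounds (a round is a span of time in which each particle is activated at least once), and at all later stages, the following holds on every directrix, where particles are ordered starting from the Leader. 1. The scale $\lambda$ is stored in binary, one digit per particle, least significant digit first. 2. Every particle has a Role, which is the identifier of an element of $R$. The particles with the same Role are contiguous, and the Roles are in this order of kind: super-vertices, partial super-edges, super-edges, partial super-triangles, super-triangles. 3. The particles with the flag Double (those that are going to be expanded) are exactly the last $d$ ones.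 4. For each element $x\in R$, the number of particles with Role $x$, where each Double particle counts twice, is the number of grid vertices in $x$. 5. If $S_F$ has at least one triangle, then all Double particles have Roles corresponding to (partial) super-triangles. If $S_F$ consists only of edges, then all Double particles on the same directrix have a Role corresponding to the same (partial) super-edge. -/

import Mathlib

namespace Particles

noncomputable section

/-! ## The triangular grid -/

/-- A vertex `(a, b)` of the infinite triangular grid, drawn at the point `a + b * exp (i π / 3)` of
the plane. -/
abbrev Vertex := ℤ × ℤ

/-- The six unit vectors of the grid, in counterclockwise order; `dir (d + 3) = - dir d`. -/
def dir : Fin 6 → Vertex := ![(1, 0), (0, 1), (-1, 1), (-1, 0), (0, -1), (1, -1)]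

def Adj (u v : Vertex) : Prop := ∃ d : Fin 6, v = u + dir d

/-- The counterclockwise rotation by 60 degrees about the origin. -/
def rot60 (v : Vertex) : Vertex := (-v.2, v.1 + v.2)

/-- For `k ∈ {1, 2, 3}`, the rotations `gridRotation k s`, `s` a vertex, are all the counterclockwise
rotations of the plane by `2 π / k` that map the grid to itself (for `k = 1`, the translations). -/
def gridRotation (k : ℕ) (s : Vertex) (v : Vertex) : Vertex := rot60^[6 / k] v + s

/-! ## Shapes -/

/-- A shape: a non-empty connected subset of the plane that is a union of finitely many edges and
faces of the drawing of the grid. It is represented by the set of all vertices, edges and faces of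
the drawing that it contains, each given as the set of its 1, 2 or 3 vertices (the non-empty sets of
pairwise adjacent vertices of the grid are exactly its vertices, edges and faces). -/
structure Shape where
  cells : Finset (Finset Vertex)
  nonempty : cells.Nonempty
  cell_nonempty : ∀ σ ∈ cells, σ.Nonempty
  cell_adj : ∀ σ ∈ cells, ∀ u ∈ σ, ∀ v ∈ σ, u ≠ v → Adj u v
  closed : ∀ σ ∈ cells, ∀ τ ⊆ σ, τ.Nonempty → τ ∈ cells
  /-- every vertex of the shape lies on an edge of the shape: there are no isolated points -/
  covered : ∀ u : Vertex, {u} ∈ cells → ∃ v, v ≠ u ∧ {u, v} ∈ cells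
  connected : ∀ u v : Vertex, {u} ∈ cells → {v} ∈ cells →
    Relation.ReflTransGen (fun a b => ({a, b} : Finset Vertex) ∈ cells) u v

namespace Shape

/-- The size of a shape: the number of vertices of the grid that lie in it. -/
def size (S : Shape) : ℕ := (S.cells.filter fun σ => σ.card = 1).card

def HasTriangle (S : Shape) : Prop := ∃ σ ∈ S.cells, σ.card = 3

/-- `gridRotation k s` is a `k`-fold rotational symmetry of `S` whose center is not a vertex of the
grid. -/
def IsUnbreakableRotation (S : Shape) (k : ℕ) (s : Vertex) : Prop :=
  (∀ σ ∈ S.cells, σ.image (gridRotation k s) ∈ S.cells) ∧ ∀ v : Vertex, gridRotation k s v ≠ v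

/-- What is assumed on the final shape when there are `k` Leaders: nothing if `k = 1` (then
`gridRotation k s` is the identity), and unbreakable `k`-symmetry, with rotation `gridRotation k s`, if
`k ∈ {2, 3}`. -/
def Compatible (S : Shape) (k : ℕ) (s : Vertex) : Prop :=
  (k = 1 ∧ s = 0) ∨ ((k = 2 ∨ k = 3) ∧ S.IsUnbreakableRotation k s)

end Shape

/-! ## The elements of the scaled shape -/

/-- The name of an element of a scaled copy of a shape. `whole σ` is the super-vertex, super-edge or
super-triangle that comes from the vertex, edge or face `σ`; `part σ v` is the partial super-edge or
partial super-triangle, cut from the edge or face `σ` through the center of symmetry, that contains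
the corner `v` of `σ`. -/
inductive Element where
  | whole (σ : Finset Vertex)
  | part (σ : Finset Vertex) (v : Vertex)
  deriving DecidableEq

namespace Element

/-- The vertex, edge or face of the unscaled shape that an element comes from. -/
def cell : Element → Finset Vertex
  | whole σ => σ
  | part σ _ => σ

/-- super-vertices, then partial super-edges, then super-edges, then partial super-triangles, then
super-triangles -/
def rank : Element → ℕ
  | whole σ => 2 * σ.card
  | part σ _ => 2 * σ.card - 1

/-- The action of a rotation on elements. -/
def rotate (ρ : Vertex → Vertex) : Element → Element
  | whole σ => whole (σ.image ρ)
  | part σ v => part (σ.image ρ) (ρ v)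

/-- The vertices of the grid in an element of the copy of the shape scaled by `l`.

A vertex of the grid lies in the interior of the scaled simplex `l • σ` if and only if it is
`∑ v ∈ σ, w v • v` with positive integers `w v` of sum `l`.
For `k = 2`, the edge `σ = {v, ρ v}` is cut at its midpoint.
For `k = 3`, the face `σ` has corners `v`, `ρ v`, `ρ (ρ v)` in counterclockwise order and it is cut
along the three rays that leave its center `w v = w (ρ v) = w (ρ (ρ v)) = l / 3` in the directions of
its sides, oriented counterclockwise; these rays lie on the lines `w v = l / 3`,
`w (ρ v) = l / 3`, `w (ρ (ρ v)) = l / 3`. -/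
def points (k : ℕ) (s : Vertex) (l : ℕ) : Element → Set Vertex
  | whole σ => {p | ∃ w : Vertex → ℕ, (∀ v ∈ σ, 0 < w v) ∧ ∑ v ∈ σ, w v = l ∧
      ∑ v ∈ σ, w v • v = p}
  | part σ v => {p | ∃ w : Vertex → ℕ, (∀ v ∈ σ, 0 < w v) ∧ ∑ v ∈ σ, w v = l ∧
      ∑ v ∈ σ, w v • v = p ∧ l < k * w v ∧ k * w (gridRotation k s v) < l}

/-- The number of vertices of the grid in an element at scale `l`. -/
def area (k : ℕ) (s : Vertex) (l : ℕ) (x : Element) : ℕ := (x.points k s l).ncard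

end Element

/-- The elements of the scaled copies of `S` when there are `k` Leaders: the cells of `S`, except
that for `k > 1` the cell through the center of symmetry (the one that is mapped to itself by the
rotation), if there is one, is replaced by its parts. -/
def Shape.elements (S : Shape) (k : ℕ) (s : Vertex) : Set Element :=
  {x | (∃ σ ∈ S.cells, (k = 1 ∨ σ.image (gridRotation k s) ≠ σ) ∧ x = .whole σ) ∨
    ∃ σ ∈ S.cells, (k ≠ 1 ∧ σ.image (gridRotation k s) = σ) ∧ ∃ v ∈ σ, x = .part σ v}

/-- `R` is a selection of the elements for one Leader: the elements are divided into the `k`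
symmetric regions `R`, `ρ R`, …, `ρ ^ (k - 1) R`, one for each Leader, with `ρ = gridRotation k s`.
Each Leader names the elements of its own region by the corresponding elements of `R`. -/
def Shape.IsSelection (S : Shape) (k : ℕ) (s : Vertex) (R : Finset Element) : Prop :=
  (∀ x ∈ R, x ∈ S.elements k s) ∧
    ∀ x ∈ S.elements k s, ∃! j : Fin k, ∃ y ∈ R, (Element.rotate (gridRotation k s))^[(j : ℕ)] y = x

/-- The number of vertices of the grid in the region of one Leader at scale `l`. -/
def regionArea (k : ℕ) (s : Vertex) (R : Finset Element) (l : ℕ) : ℕ := ∑ x ∈ R, x.area k s l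

/-- `l` is the scale for teams of `N` particles: the first of `7, 13, 19, …` for which the region of
a Leader has at least `N` vertices. -/
def IsScale (k : ℕ) (s : Vertex) (R : Finset Element) (N l : ℕ) : Prop :=
  7 ≤ l ∧ l % 6 = 1 ∧ N ≤ regionArea k s R l ∧
    ∀ l', 7 ≤ l' → l' % 6 = 1 → l' < l → regionArea k s R l' < N

/-! ## Particles -/

/-- What an active particle sees in a vertex adjacent to its head. -/
inductive Content where
  | unoccupied
  | ownTail
  | otherHead
  | otherTail

inductive Operation where
  | stay
  | contract
  | expand (port : Fin 6)

/-- A deterministic algorithm of finite-state particles: it maps the internal state, what is seen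
through the six ports and the messages read from the six ports (`none` if there is no message) to
the new internal state, the messages sent through the six ports and an operation. -/
structure Algorithm where
  Q : Type
  M : Type
  finite_Q : Finite Q
  finite_M : Finite M
  next : Q → (Fin 6 → Content) → (Fin 6 → Option M) → Q × (Fin 6 → Option M) × Operation

/-- The port labeling of a particle: the direction of port 0, and the handedness. -/
structure Ports where
  zero : Fin 6
  rightHanded : Bool

/-- The direction of a port: ports are numbered clockwise by a right-handed particle and
counterclockwise by a left-handed one. -/
def Ports.toDir (l : Ports) (i : Fin 6) : Fin 6 := if l.rightHanded then l.zero - i else l.zero + i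

/-- The port in a direction; the inverse of `Ports.toDir`. -/
def Ports.toPort (l : Ports) (d : Fin 6) : Fin 6 := if l.rightHanded then l.zero - d else d - l.zero

theorem Ports.toDir_toPort (l : Ports) (d : Fin 6) : l.toDir (l.toPort d) = d := by
  unfold toDir toPort; split <;> simp

theorem Ports.toPort_toDir (l : Ports) (i : Fin 6) : l.toPort (l.toDir i) = i := by
  unfold toDir toPort; split <;> simp

/-- A configuration of a system with set of particles `P`. `inbox p d` is the unread message, if any,
that was sent to the head of `p` from the adjacent vertex in direction `d`. (The head of a particle
moves only when the particle is active and so has read and destroyed all its messages; hence unread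
messages can be recorded with their addressee.) -/
@[ext] structure Config (P Q M : Type) where
  state : P → Q
  head : P → Vertex
  tail : P → Option Vertex
  inbox : P → Fin 6 → Option M

section Dynamics

variable {P : Type} (A : Algorithm) (port : P → Ports)

open Classical in
/-- What `p` sees in direction `d`. -/
def content (c : Config P A.Q A.M) (p : P) (d : Fin 6) : Content :=
  if c.tail p = some (c.head p + dir d) then .ownTail
  else if ∃ q, c.head q = c.head p + dir d then .otherHead
  else if ∃ q, c.tail q = some (c.head p + dir d) then .otherTail
  else .unoccupied

/-- What `p` does if it is active in configuration `c`. -/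
def act (c : Config P A.Q A.M) (p : P) : A.Q × (Fin 6 → Option A.M) × Operation :=
  A.next (c.state p) (fun i => content A c p ((port p).toDir i))
    (fun i => c.inbox p ((port p).toDir i))

open Classical in
/-- The message, if any, that is sent to the head of `p` from direction `d` when the particles of
`active` are active. -/
def sent (active : Set P) (c : Config P A.Q A.M) (p : P) (d : Fin 6) : Option A.M :=
  if h : ∃ q ∈ active, c.head q = c.head p + dir d
  then (act A port c h.choose).2.1 ((port h.choose).toPort (d + 3))
  else none

/-- `p` is active, contracted, and tries to expand toward the unoccupied vertex `v`. -/
def Attempts (active : Set P) (c : Config P A.Q A.M) (p : P) (v : Vertex) : Prop :=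
  p ∈ active ∧ c.tail p = none ∧
    (∃ i, (act A port c p).2.2 = .expand i ∧ v = c.head p + dir ((port p).toDir i)) ∧
    ∀ q, c.head q ≠ v ∧ c.tail q ≠ some v

open Classical in
/-- One stage, in which exactly the particles of `active` are active, leads from `c` to `c'`. Here
`win` is the set of the particles that succeed in expanding, one for each vertex toward which some
particle tries to expand. -/
def Step (active : Set P) (c c' : Config P A.Q A.M) : Prop :=
  ∃ win : Set P,
    (∀ p ∈ win, ∃ v, Attempts A port active c p v) ∧
    (∀ v, (∃ p, Attempts A port active c p v) → ∃! p, p ∈ win ∧ Attempts A port active c p v) ∧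
    (∀ p, c'.state p = if p ∈ active then (act A port c p).1 else c.state p) ∧
    (∀ p ∈ win, Attempts A port active c p (c'.head p) ∧ c'.tail p = some (c.head p)) ∧
    (∀ p ∉ win, c'.head p = c.head p ∧
      c'.tail p = if p ∈ active ∧ (act A port c p).2.2 = .contract then none else c.tail p) ∧
    (∀ p d, c'.inbox p d =
      if p ∈ win then none
      else if (sent A port active c p d).isSome then sent A port active c p d
      else if p ∈ active then none else c.inbox p d)

end Dynamics

/-- The scheduler activates each particle infinitely often. -/
def Fair {P : Type} (active : ℕ → Set P) : Prop := ∀ p t, ∃ u, t ≤ u ∧ p ∈ active u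

/-- The stage at which the `r`-th round ends; each round ends as soon as each particle has been
active at least once in it. -/
def roundEnd {P : Type} (active : ℕ → Set P) : ℕ → ℕ
  | 0 => 0
  | r + 1 => sInf {t | ∀ p, ∃ u, roundEnd active r ≤ u ∧ u < t ∧ p ∈ active u}

/-! ## The role assignment phase -/

/-- An algorithm for the role assignment phase, with the internal states of the particles at the
beginning of the phase (a Leader knows the number of Leaders and the port toward its directrix;
the other particles know nothing) and the internal variables that the phase computes. -/
structure RoleAlgorithm extends Algorithm where
  /-- the initial state of the particles that are not Leaders -/
  idle : Q
  /-- the initial state of a Leader, as a function of the number of Leaders and of the port -/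
  leader : ℕ → Fin 6 → Q
  /-- the variable Role, `none` if it is Undefined -/
  role : Q → Option Element
  /-- the flag Double -/
  double : Q → Bool
  /-- the binary digit of the scale that is stored in a particle -/
  digit : Q → Bool
  role_idle : role idle = none
  role_leader : ∀ k i, role (leader k i) = none

/-- `k` directrices with `N` particles each: the Leaders `(j, 0)` are pairwise adjacent, the `j`-th
team is a straight segment that starts at its Leader, and, if `k > 1`, there is a second Leader on
the extension of this segment beyond its Leader. -/
structure Directrices (k N : ℕ) where
  leaderPos : Fin k → Vertex
  dirn : Fin k → Fin 6
  adj : ∀ i j, i ≠ j → Adj (leaderPos i) (leaderPos j)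
  extension : 1 < k → ∀ i, ∃ j, j ≠ i ∧ leaderPos j = leaderPos i + dir (dirn i + 3)
  injective : Function.Injective fun p : Fin k × Fin N =>
    leaderPos p.1 + (p.2 : ℕ) • dir (dirn p.1)

/-- The position of the `i`-th particle on the `j`-th directrix, where `p = (j, i)`. -/
def Directrices.pos {k N : ℕ} (D : Directrices k N) (p : Fin k × Fin N) : Vertex :=
  D.leaderPos p.1 + (p.2 : ℕ) • dir (D.dirn p.1)

/-- The configuration at the beginning of the phase. -/
def RoleAlgorithm.initial (A : RoleAlgorithm) {k N : ℕ} (D : Directrices k N)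
    (port : Fin k × Fin N → Ports) : Config (Fin k × Fin N) A.Q A.M where
  state p := if (p.2 : ℕ) = 0 then A.leader k ((port p).toPort (D.dirn p.1)) else A.idle
  head := D.pos
  tail _ := none
  inbox _ _ := none

/-- The team of `N` particles with internal states `q 0, …, q (N - 1)`, in the order in which they
lie on the directrix starting from the Leader, has completed the role assignment at scale `l` for
the region `R`. -/
structure RolesAssigned (A : RoleAlgorithm) (S : Shape) (k : ℕ) (s : Vertex) (R : Finset Element)
    {N : ℕ} (l : ℕ) (q : Fin N → A.Q) : Prop where
  /-- the team stores the scale in binary -/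
  scale : ∑ i, (if A.digit (q i) then 2 ^ (i : ℕ) else 0) = l
  /-- every particle has a Role -/
  role : ∀ i, ∃ x ∈ R, A.role (q i) = some x
  /-- the particles with the same Role are contiguous -/
  chunk : ∀ i₁ i₂ i₃, i₁ ≤ i₂ → i₂ ≤ i₃ → A.role (q i₁) = A.role (q i₃) →
    A.role (q i₂) = A.role (q i₁)
  /-- the order of the kinds of elements -/
  order : ∀ i₁ i₂, i₁ ≤ i₂ → ∀ x y, A.role (q i₁) = some x → A.role (q i₂) = some y →
    x.rank ≤ y.rank
  /-- the Double particles are the last ones, as many as are missing for one particle per vertex -/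
  double : ∀ i : Fin N, A.double (q i) = true ↔ N ≤ i + (regionArea k s R l - N)
  /-- the chunk of `x` fills `x` if each Double particle occupies two vertices -/
  area : ∀ x ∈ R, ∑ i, (if A.role (q i) = some x then if A.double (q i) then 2 else 1 else 0) =
    x.area k s l
  /-- if the shape has triangles, then the Double particles are in (partial) super-triangles -/
  triangle : S.HasTriangle → ∀ i, A.double (q i) = true →
    ∃ x ∈ R, A.role (q i) = some x ∧ x.cell.card = 3
  /-- otherwise they are all in one (partial) super-edge -/
  edge : ¬ S.HasTriangle → ∃ x ∈ R, x.cell.card = 2 ∧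
    ∀ i, A.double (q i) = true → A.role (q i) = some x

end

end Particles

/-! At scale `6 * q + 1` an element contains `1`, `3q`, `6q`, `q(6q-1)` or `3q(6q-1)` grid vertices,
according to its kind. Passing from `q` to `q + 1` adds `aq + b`, where `a` and `b` depend only on
the kind (`area_eq_rankArea`, `rankArea_succ`). Each team can therefore tabulate these numbers with
one finite-state token that sweeps along its directrix. Numbers are stored in unary, as flags on
initial segments of the line, and one sweep adds bounded constants to all of them (`counter_sweep`).
The next scale is reached by `q` sweeps that add the `a`'s and one sweep that adds the `b`'s
(`counter_halts`). The counters hold the partial sums of the areas of the elements of `R`, sorted by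
kind, that is, the boundaries between the Roles. The last one is the area of the whole region. The
run stops at the first scale at which it reaches `N`, and its overflow `d` is laid down from the far
end as Double flags. The scale is updated in binary during the same sweeps.

A sweep takes `2 * (N - 1)` moves. With triangles the area is at least quadratic in `q`, so the
sweeps, about `1 + 2 + ⋯ + q` of them, number at most `N`. Without triangles `q` may be of order
`N`, but then all `a` vanish and the inner loop is switched off. Both cases need `O(N ^ 2)` moves.

The previous scale was too small, so `d` is less than the growth of the region in one step, which is
at most `36(q+1)` per element, and at most `6` if there are only edges. As `R` has `O(m)` elements
and `n ≥ C m ^ 3` makes `q` large compared with `m`, `2 * d` is at most the area of the last element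
of the sorted list (`two_mul_excess_le`). Hence all Double particles lie in the last chunk, whose
kind is the highest one present (`rolesAssigned_of_boundaries`).

In the distributed system the token is the only message of its team. It always leaves through the
port it came from or the opposite one, so port labelings are irrelevant. The far end is recognized
by the free vertex ahead (`Directrices.pos_ne_end`). The invariant `Sweeper.Matches` turns stages
into moves of the tokens (`Sweeper.Matches.step`), and every round contains a move of each surviving
token (`Sweeper.exists_moves`). -/

namespace Particles

noncomputable section

/-! ## Token machines on a line -/

/-- A finite-state token that sweeps back and forth over a line of cells. -/
structure Sweeper (Γ R L : Type) where
  right : Γ → R → Γ × R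
  turn : R → L
  left : Γ → L → Γ × L
  ctrl : L → Option R

namespace Sweeper

variable {Γ R L : Type} (W : Sweeper Γ R L)

/-- The effect of the token on the cell that it visits, and the token that leaves the cell. -/
def visit (first last : Bool) (g : Γ) : R ⊕ L → Γ × Option (R ⊕ L)
  | .inl r =>
    if last then
      ((W.left (W.right g r).1 (W.turn (W.right g r).2)).1,
        some (.inr (W.left (W.right g r).1 (W.turn (W.right g r).2)).2))
    else ((W.right g r).1, some (.inl (W.right g r).2))
  | .inr l =>
    if first then
      match W.ctrl (W.left g l).2 with
      | none => ((W.left g l).1, none)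
      | some r => ((W.right (W.left g l).1 r).1, some (.inl (W.right (W.left g l).1 r).2))
    else ((W.left g l).1, some (.inr (W.left g l).2))

/-- The cell that is reached by a token that leaves cell `a`. -/
def target (a : ℕ) : R ⊕ L → ℕ
  | .inl _ => a + 1
  | .inr _ => a - 1

/-- A line of cells and the token, if it still exists, with the cell that it is about to visit. -/
abbrev Line (Γ R L : Type) := (ℕ → Γ) × Option (ℕ × (R ⊕ L))

/-- One move of the token on a line of `N` cells. -/
def advance (N : ℕ) : Line Γ R L → Line Γ R L
  | (w, none) => (w, none)
  | (w, some (a, m)) =>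
    (Function.update w a (W.visit (decide (a = 0)) (decide (a + 1 = N)) (w a) m).1,
      (W.visit (decide (a = 0)) (decide (a + 1 = N)) (w a) m).2.map fun m' => (target a m', m'))

/-! ### The distributed algorithm -/

/-- The state of a particle: a Leader that has not been active yet, or a cell (of a Leader or not). -/
abbrev PState (Γ : Type) := (Fin 4 × Fin 6) ⊕ (Bool × Γ)

-- The choice is harmless: a particle never has more than one unread message in the runs considered.
open Classical in
def incoming {M : Type} (msg : Fin 6 → Option M) : Option (Fin 6 × M) :=
  if h : ∃ i, (msg i).isSome then some (h.choose, (msg h.choose).get h.choose_spec) else none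

theorem incoming_eq_none {M : Type} {msg : Fin 6 → Option M} (h : ∀ i, msg i = none) :
    incoming msg = none := by
  simp [incoming, h]

theorem incoming_eq_some {M : Type} {msg : Fin 6 → Option M} {i : Fin 6} {m : M}
    (h : msg i = some m) (h' : ∀ i', i' ≠ i → msg i' = none) : incoming msg = some (i, m) := by
  have hex : ∃ i, (msg i).isSome := ⟨i, by simp [h]⟩
  have hi : hex.choose = i := by
    by_contra hne
    have := hex.choose_spec
    rw [h' _ hne] at this
    simp at this
  unfold incoming
  rw [dif_pos hex]
  simp [hi, h]

/-- A token that keeps its sense of motion leaves opposite to its arrival port, and a token that is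
reflected goes back. Opposite ports differ by 3 for both handednesses. -/
def outPort (i : Fin 6) : R ⊕ L → R ⊕ L → Fin 6
  | .inl _, .inl _ => i + 3
  | .inr _, .inr _ => i + 3
  | _, _ => i

def isFree : Content → Bool
  | .unoccupied => true
  | _ => false

variable (blank : Γ) (start : Fin 4 → R)

/-- The end of the line is detected by a free vertex opposite to the arrival port. For tokens on the
way back this test says nothing about the end, but `visit` ignores it then. The first visit treats
the Leader as not last, which is right for `2 ≤ N`. -/
def next : PState Γ → (Fin 6 → Content) → (Fin 6 → Option (R ⊕ L)) →
    PState Γ × (Fin 6 → Option (R ⊕ L)) × Operation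
  | .inl (k, i), _, _ =>
    (.inr (true, (W.visit true false blank (.inl (start k))).1),
      fun i' => if i' = i then (W.visit true false blank (.inl (start k))).2 else none, .stay)
  | .inr (b, g), see, msg =>
    match incoming msg with
    | none => (.inr (b, g), fun _ => none, .stay)
    | some (i, m) =>
      (.inr (b, (W.visit b (isFree (see (i + 3))) g m).1),
        fun i' => (W.visit b (isFree (see (i + 3))) g m).2.bind fun m' =>
          if i' = outPort i m m' then some m' else none, .stay)

theorem next_stay (q : PState Γ) (see : Fin 6 → Content) (msg : Fin 6 → Option (R ⊕ L)) :
    (W.next blank start q see msg).2.2 = .stay := by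
  unfold next
  split
  · rfl
  · split <;> rfl

theorem next_of_none {b : Bool} {g : Γ} {see : Fin 6 → Content} {msg : Fin 6 → Option (R ⊕ L)}
    (h : incoming msg = none) :
    W.next blank start (.inr (b, g)) see msg = (.inr (b, g), fun _ => none, .stay) := by
  simp only [next, h]

theorem next_of_some {b : Bool} {g : Γ} {see : Fin 6 → Content} {msg : Fin 6 → Option (R ⊕ L)}
    {i : Fin 6} {m : R ⊕ L} (h : incoming msg = some (i, m)) :
    W.next blank start (.inr (b, g)) see msg =
      (.inr (b, (W.visit b (isFree (see (i + 3))) g m).1),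
        fun i' => (W.visit b (isFree (see (i + 3))) g m).2.bind fun m' =>
          if i' = outPort i m m' then some m' else none, .stay) := by
  simp only [next, h]

abbrev algorithm [Finite Γ] [Finite R] [Finite L] : Algorithm where
  Q := PState Γ
  M := R ⊕ L
  finite_Q := inferInstance
  finite_M := inferInstance
  next := W.next blank start

end Sweeper

/-! ## Geometry of the directrices -/

theorem dir_add_three (d : Fin 6) : dir (d + 3) = -dir d := by
  fin_cases d <;> simp [dir]

theorem dir_injective : Function.Injective dir := by
  intro a b; revert a b; unfold dir; decide

theorem dir_ne_zero (d : Fin 6) : dir d ≠ 0 := by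
  revert d; unfold dir; decide

theorem fin_six_add_three (d : Fin 6) : d + 3 + 3 = d := by revert d; decide

theorem Ports.toPort_add_three (l : Ports) (d : Fin 6) : l.toPort (d + 3) = l.toPort d + 3 := by
  unfold Ports.toPort
  generalize l.zero = z
  split
  · revert z d; decide
  · revert z d; decide

theorem Ports.toPort_injective (l : Ports) : Function.Injective l.toPort := fun a b h => by
  rw [← l.toDir_toPort a, h, l.toDir_toPort]

namespace Directrices

variable {k N : ℕ} (D : Directrices k N)

theorem pos_injective : Function.Injective D.pos := D.injective

/-- The vertex next to the last particle of a directrix, away from the Leader, is unoccupied. -/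
theorem pos_ne_end (hN : 2 ≤ N) (j : Fin k) (p : Fin k × Fin N) :
    D.pos p ≠ D.leaderPos j + N • dir (D.dirn j) := by
  obtain ⟨i, a⟩ := p
  intro h
  unfold pos at h
  simp only at h
  by_cases hij : i = j
  · subst hij
    have h0 := add_left_cancel h
    have ha := a.2
    have : ((N : ℤ) - (a : ℕ)) • dir (D.dirn i) = 0 := by
      rw [sub_smul, natCast_zsmul, natCast_zsmul, h0, sub_self]
    rcases smul_eq_zero.1 this with h1 | h1
    · omega
    · exact dir_ne_zero _ h1
  · have hk : 1 < k := by
      have h1 := i.2; have h2 := j.2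
      by_contra hk
      exact hij (Fin.ext (by omega))
    obtain ⟨i', hi', ei⟩ := D.extension hk i
    obtain ⟨j', hj', ej⟩ := D.extension hk j
    rw [dir_add_three] at ei ej
    obtain ⟨e, he⟩ := D.adj i j hij
    -- The Leader behind `i` is equal or adjacent to Leader `j`, so directrix `i` points away from
    -- `j`; symmetrically with `i` and `j` exchanged.
    have key1 : D.leaderPos i' = D.leaderPos j ∨ Adj (D.leaderPos i') (D.leaderPos j) := by
      by_cases h : i' = j
      · left; rw [h]
      · right; exact D.adj _ _ h
    have key2 : D.leaderPos j' = D.leaderPos i ∨ Adj (D.leaderPos j') (D.leaderPos i) := by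
      by_cases h : j' = i
      · left; rw [h]
      · right; exact D.adj _ _ h
    rw [ei, he] at key1
    rw [ej, he] at key2
    rw [he] at h
    revert h key1 key2
    generalize D.leaderPos i = u
    generalize D.dirn i = x
    generalize D.dirn j = y
    generalize (a : ℕ) = n
    unfold Adj
    -- The form is twice the Euclidean inner product. With `e` the direction from Leader `i` to
    -- Leader `j`, points of directrix `i` have non-positive component along `e`, while the end of
    -- directrix `j` has positive component.
    have hx : ∀ x e : Fin 6, (-dir x = dir e ∨ ∃ d : Fin 6, dir e = -dir x + dir d) →
        2 * (dir x).1 * (dir e).1 + 2 * (dir x).2 * (dir e).2 +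
          (dir x).1 * (dir e).2 + (dir x).2 * (dir e).1 ≤ -1 := by
      unfold dir; decide
    have hy : ∀ y e : Fin 6, (dir e + -dir y = 0 ∨ ∃ d : Fin 6, 0 = dir e + -dir y + dir d) →
        1 ≤ 2 * (dir y).1 * (dir e).1 + 2 * (dir y).2 * (dir e).2 +
          (dir y).1 * (dir e).2 + (dir y).2 * (dir e).1 := by
      unfold dir; decide
    have hz : ∀ e : Fin 6, 2 * (dir e).1 * (dir e).1 + 2 * (dir e).2 * (dir e).2 +
          (dir e).1 * (dir e).2 + (dir e).2 * (dir e).1 = 2 := by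
      unfold dir; decide
    intro h key1 key2
    have k1 := hx x e (by simpa [add_assoc] using key1)
    have k2 := hy y e (by simpa [add_assoc, eq_comm] using key2)
    have k3 := hz e
    have h1 := congrArg Prod.fst h
    have h2 := congrArg Prod.snd h
    simp only [Prod.fst_add, Prod.snd_add, Prod.smul_fst, Prod.smul_snd] at h1 h2
    rw [nsmul_eq_mul, nsmul_eq_mul] at h1 h2
    have k4 := mul_le_mul_of_nonneg_left k1 (Int.natCast_nonneg n)
    have k5 := mul_le_mul_of_nonneg_left k2 (Int.natCast_nonneg N)
    have k6 : (0 : ℤ) ≤ n := Int.natCast_nonneg n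
    have k7 : (0 : ℤ) ≤ N := Int.natCast_nonneg N
    have h3 : (n : ℤ) * (dir x).1 = (dir e).1 + N * (dir y).1 := by linarith
    have h4 : (n : ℤ) * (dir x).2 = (dir e).2 + N * (dir y).2 := by linarith
    have h5 : (n : ℤ) * (2 * (dir x).1 * (dir e).1 + 2 * (dir x).2 * (dir e).2 +
        (dir x).1 * (dir e).2 + (dir x).2 * (dir e).1) = 2 +
        N * (2 * (dir y).1 * (dir e).1 + 2 * (dir y).2 * (dir e).2 +
          (dir y).1 * (dir e).2 + (dir y).2 * (dir e).1) := by
      linear_combination k3 + (2 * (dir e).1 + (dir e).2) * h3 + (2 * (dir e).2 + (dir e).1) * h4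
    linarith

/-- The particle in front of a particle, on the way to the end of the directrix. -/
theorem pos_add_dir {j : Fin k} {i i' : Fin N} (h : (i' : ℕ) = i + 1) :
    D.pos (j, i) + dir (D.dirn j) = D.pos (j, i') := by
  simp only [pos, h, succ_nsmul, add_assoc]

theorem pos_sub_dir {j : Fin k} {i i' : Fin N} (h : (i : ℕ) = i' + 1) :
    D.pos (j, i) + dir (D.dirn j + 3) = D.pos (j, i') := by
  rw [← D.pos_add_dir h, dir_add_three, add_neg_cancel_right]

end Directrices

namespace Sweeper

variable {Γ R L : Type} (W : Sweeper Γ R L) (blank : Γ) (start : Fin 4 → R)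

/-! ### Correspondence of configurations and lines -/

/-- The direction from which a token arrives, on a directrix with direction `d`. -/
def arrival (d : Fin 6) : R ⊕ L → Fin 6
  | .inl _ => d + 3
  | .inr _ => d

/-- The direction in which a token moves, on a directrix with direction `d`. -/
def heading (d : Fin 6) : R ⊕ L → Fin 6
  | .inl _ => d
  | .inr _ => d + 3

/-- The token is still with the Leader, which has not been active yet. -/
def Waiting (X : Line Γ R L) : Prop := ∃ r, X.2 = some (0, .inl r)

/-- The last cell handles arrival and return in one visit, and so does the first. Thus a returning
token is never about to visit the last cell, and an outgoing one is about to visit cell `0` only at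
the very beginning. -/
def Valid (N : ℕ) (r₀ : R) (X : Line Γ R L) : Prop :=
  ∀ a m, X.2 = some (a, m) → a < N ∧ (∀ l, m = .inr l → a + 1 < N) ∧
    ∀ r, m = .inl r → a = 0 → r = r₀ ∧ X.1 0 = blank

open Classical in
def cellState (k₀ : Fin 4) (i₀ : Fin 6) (X : Line Γ R L) (i : ℕ) : PState Γ :=
  if i = 0 ∧ Waiting X then .inl (k₀, i₀) else .inr (decide (i = 0), X.1 i)

-- The token about to visit a cell is the unread message of the corresponding particle. The initial
-- token is the exception: it is encoded in the state of the Leader.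
open Classical in
def pending (d : Fin 6) (X : Line Γ R L) (i : ℕ) (e : Fin 6) : Option (R ⊕ L) :=
  if Waiting X then none
  else X.2.bind fun am => if i = am.1 ∧ e = arrival d am.2 then some am.2 else none

theorem Valid.advance {N : ℕ} (hN : 2 ≤ N) {r₀ : R} {X : Line Γ R L} (h : Valid blank N r₀ X) :
    Valid blank N r₀ (W.advance N X) := by
  obtain ⟨w, _ | ⟨a, m⟩⟩ := X
  · exact h
  · obtain ⟨h1, h2, -⟩ := h a m rfl
    intro a' m' hm
    simp only [Sweeper.advance, Option.map_eq_some_iff, Prod.mk.injEq] at hm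
    obtain ⟨m'', hm, rfl, rfl⟩ := hm
    rcases m with r | l
    · by_cases ha : a + 1 = N
      · simp only [visit, ha, decide_true, if_true, Option.some.injEq] at hm
        subst hm
        simp [target]
        omega
      · simp [visit, ha] at hm
        subst hm
        simp [target]
        omega
    · have h2 := h2 l rfl
      by_cases ha : a = 0
      · simp only [visit, ha, decide_true, if_true] at hm
        split at hm
        · simp at hm
        · simp at hm
          subst hm
          simp [target]
          omega
      · simp [visit, ha] at hm
        subst hm
        simp [target]
        omega

/-- The position of the token. -/
def Holds (X : Line Γ R L) (i : ℕ) : Prop := ∃ m, X.2 = some (i, m)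

variable [Finite Γ] [Finite R] [Finite L] {k N : ℕ} (D : Directrices k N)
  (port : Fin k × Fin N → Ports) (k₀ : Fin 4)

/-- The invariant of the simulation: the teams are independent, each is described by its own
abstract line, and nobody has moved. -/
structure Matches (X : Fin k → Line Γ R L)
    (c : Config (Fin k × Fin N) (W.algorithm blank start).Q (W.algorithm blank start).M) :
    Prop where
  head : ∀ p, c.head p = D.pos p
  tail : ∀ p, c.tail p = none
  state : ∀ j i, c.state (j, i) = cellState k₀ ((port (j, i)).toPort (D.dirn j)) (X j) i
  inbox : ∀ j i e, c.inbox (j, i) e = pending (D.dirn j) (X j) i e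
  valid : ∀ j, Valid blank N (start k₀) (X j)

end Sweeper

/-! ### Stages of the system as moves of the tokens -/

namespace Sweeper

variable {Γ R L : Type} {W : Sweeper Γ R L} {blank : Γ}
  {start : Fin 4 → R}

theorem arrival_add_three (d : Fin 6) (m : R ⊕ L) : arrival d m + 3 = heading d m := by
  cases m <;> simp [arrival, heading, fin_six_add_three]

theorem heading_add_three (d : Fin 6) (m : R ⊕ L) : heading d m + 3 = arrival d m := by
  cases m <;> simp [arrival, heading, fin_six_add_three]

theorem not_waiting_advance (N : ℕ) (X : Line Γ R L) (h : X.2.isSome) :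
    ¬ Waiting (W.advance N X) := by
  obtain ⟨w, _ | ⟨a, m⟩⟩ := X
  · simp at h
  · rintro ⟨r, hr⟩
    simp only [advance, Option.map_eq_some_iff, Prod.mk.injEq] at hr
    obtain ⟨m', -, h1, rfl⟩ := hr
    simp [target] at h1

theorem advance_eq_self (N : ℕ) (X : Line Γ R L) (h : X.2 = none) : W.advance N X = X := by
  obtain ⟨w, t⟩ := X
  simp only at h
  subst h
  rfl

theorem visit_inr (b x y : Bool) (g : Γ) (l : L) :
    W.visit b x g (.inr l) = W.visit b y g (.inr l) := rfl

theorem pending_of_not_holds {d : Fin 6} {X : Line Γ R L} {i : ℕ} (h : ¬ Holds X i) (e : Fin 6) :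
    pending d X i e = none := by
  unfold pending
  split
  · rfl
  · rw [Option.bind_eq_none_iff]
    rintro ⟨a, m⟩ ham
    rw [if_neg]
    rintro ⟨rfl, -⟩
    exact h ⟨m, ham⟩

variable [Finite Γ] [Finite R] [Finite L] {k N : ℕ} {D : Directrices k N}
  {port : Fin k × Fin N → Ports} {k₀ : Fin 4} {X : Fin k → Line Γ R L}
  {c c' : Config (Fin k × Fin N) (W.algorithm blank start).Q (W.algorithm blank start).M}

namespace Matches

/-- Before the end, the vertex ahead is occupied by the next teammate; at the end it is free by
`Directrices.pos_ne_end`, whatever the other teams occupy. -/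
theorem isFree_content (h : Matches W blank start D port k₀ X c) (hN : 2 ≤ N) (j : Fin k)
    (i : Fin N) :
    isFree (content (W.algorithm blank start) c (j, i) (D.dirn j)) = decide ((i : ℕ) + 1 = N) := by
  unfold content
  rw [if_neg (by simp [h.tail])]
  by_cases hi : (i : ℕ) + 1 = N
  · rw [if_neg, if_neg]
    · simp [isFree, hi]
    · rintro ⟨q, hq⟩
      simp [h.tail] at hq
    · rintro ⟨q, hq⟩
      rw [h.head, h.head] at hq
      refine D.pos_ne_end hN j q ?_
      rw [hq, Directrices.pos]
      simp only
      rw [add_assoc, ← succ_nsmul, hi]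
  · rw [if_pos]
    · simp [isFree, hi]
    · refine ⟨(j, ⟨i + 1, by omega⟩), ?_⟩
      rw [h.head, h.head]
      exact (D.pos_add_dir rfl).symm

theorem act_of_holds (h : Matches W blank start D port k₀ X c) (hN : 2 ≤ N) {j : Fin k} {i : Fin N}
    {m : R ⊕ L} (hm : (X j).2 = some ((i : ℕ), m)) :
    (act (W.algorithm blank start) port c (j, i)).1 = .inr (decide ((i : ℕ) = 0),
      (W.visit (decide ((i : ℕ) = 0)) (decide ((i : ℕ) + 1 = N)) ((X j).1 i) m).1) ∧
    ∀ e, (act (W.algorithm blank start) port c (j, i)).2.1 ((port (j, i)).toPort e) =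
      (W.visit (decide ((i : ℕ) = 0)) (decide ((i : ℕ) + 1 = N)) ((X j).1 i) m).2.bind fun m' =>
        if e = heading (D.dirn j) m' then some m' else none := by
  obtain ⟨hv1, hv2, hv3⟩ := h.valid j _ _ hm
  by_cases hw : Waiting (X j)
  · obtain ⟨r, hr⟩ := hw
    have hst := h.state j i
    rw [hm] at hr
    simp only [Option.some.injEq, Prod.mk.injEq] at hr
    obtain ⟨hi, rfl⟩ := hr
    obtain ⟨rfl, hb⟩ := hv3 r rfl hi
    rw [cellState, if_pos ⟨hi, _, by rw [hm, hi]⟩] at hst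
    have hN' : ¬ (0 + 1 = N) := by omega
    have hact : act (W.algorithm blank start) port c (j, i) =
        W.next blank start (.inl (k₀, (port (j, i)).toPort (D.dirn j)))
          (fun i' => content (W.algorithm blank start) c (j, i) ((port (j, i)).toDir i'))
          (fun i' => c.inbox (j, i) ((port (j, i)).toDir i')) := by
      unfold act; rw [hst]
    rw [hact]
    simp only [next, hi, hb, hN', decide_true, decide_false]
    refine ⟨trivial, fun e => ?_⟩
    simp [visit, heading, (port (j, i)).toPort_injective.eq_iff]
    rfl
  · have hst := h.state j i
    rw [cellState, if_neg (fun h => hw h.2)] at hst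
    have hact : act (W.algorithm blank start) port c (j, i) =
        W.next blank start (.inr (decide ((i : ℕ) = 0), (X j).1 i))
          (fun i' => content (W.algorithm blank start) c (j, i) ((port (j, i)).toDir i'))
          (fun i' => c.inbox (j, i) ((port (j, i)).toDir i')) := by
      unfold act; rw [hst]
    have hin : incoming (fun i' => c.inbox (j, i) ((port (j, i)).toDir i')) =
        some ((port (j, i)).toPort (arrival (D.dirn j) m), m) := by
      apply incoming_eq_some
      · simp [h.inbox, pending, hw, hm, Ports.toDir_toPort]
      · intro i' hi'
        simp only [h.inbox, pending, hw, hm, if_false, Option.bind_some, true_and]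
        refine if_neg ?_
        intro he
        exact hi' (by rw [← he, Ports.toPort_toDir])
    -- For an outgoing token the port opposite to its arrival looks along the directrix; for a
    -- returning one the value of the test does not enter `visit`.
    have hlast : ∀ x, W.visit (decide ((i : ℕ) = 0)) (isFree (content (W.algorithm blank start) c
        (j, i) ((port (j, i)).toDir ((port (j, i)).toPort (arrival (D.dirn j) m) + 3)))) x m =
        W.visit (decide ((i : ℕ) = 0)) (decide ((i : ℕ) + 1 = N)) x m := by
      intro x
      rcases m with r | l
      · rw [← Ports.toPort_add_three, Ports.toDir_toPort, arrival_add_three]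
        simp only [heading]
        rw [h.isFree_content hN]
      · exact visit_inr _ _ _ _ _
    rw [hact, next_of_some W blank start hin]
    simp only [hlast]
    refine ⟨trivial, fun e => ?_⟩
    congr 1
    funext m'
    have : outPort ((port (j, i)).toPort (arrival (D.dirn j) m)) m m' =
        (port (j, i)).toPort (heading (D.dirn j) m') := by
      rcases m with m | m <;> rcases m' with m' | m' <;>
        simp [outPort, arrival, heading, ← Ports.toPort_add_three, fin_six_add_three]
    rw [this]
    simp [(port (j, i)).toPort_injective.eq_iff]

theorem act_of_not_holds (h : Matches W blank start D port k₀ X c) {j : Fin k}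
    {i : Fin N} (hm : ¬ Holds (X j) i) :
    (act (W.algorithm blank start) port c (j, i)).1 = c.state (j, i) ∧
    ∀ e, (act (W.algorithm blank start) port c (j, i)).2.1 e = none := by
  have hst := h.state j i
  rw [cellState, if_neg] at hst
  · have hact : act (W.algorithm blank start) port c (j, i) =
        W.next blank start (.inr (decide ((i : ℕ) = 0), (X j).1 i))
          (fun i' => content (W.algorithm blank start) c (j, i) ((port (j, i)).toDir i'))
          (fun i' => c.inbox (j, i) ((port (j, i)).toDir i')) := by
      unfold act; rw [hst]
    have hin : incoming (fun i' => c.inbox (j, i) ((port (j, i)).toDir i')) = none := by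
      apply incoming_eq_none
      intro i'
      rw [h.inbox]
      exact pending_of_not_holds hm _
    rw [hact, hst, next_of_none W blank start hin]
    simp
  · rintro ⟨hi, r, hr⟩
    exact hm ⟨_, by rw [hr, hi]⟩

/-- Tokens are reflected at both ends, so a message is always addressed to a teammate; `Valid` for
the advanced line gives the upper bound on its index. -/
theorem exists_target (h : Matches W blank start D port k₀ X c) (hN : 2 ≤ N) {j : Fin k} {a : Fin N}
    {m m' : R ⊕ L} (hm : (X j).2 = some ((a : ℕ), m))
    (hm' : (W.visit (decide ((a : ℕ) = 0)) (decide ((a : ℕ) + 1 = N)) ((X j).1 a) m).2 = some m') :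
    ∃ i : Fin N, (i : ℕ) = target a m' ∧
      D.pos (j, i) = D.pos (j, a) + dir (heading (D.dirn j) m') := by
  have hadv := Valid.advance W blank hN (h.valid j)
  have h2 : (W.advance N (X j)).2 = some (target a m', m') := by
    rw [← Prod.mk.eta (p := X j), hm]
    simp [advance, hm']
  have hlt := (hadv _ _ h2).1
  refine ⟨⟨target a m', hlt⟩, rfl, ?_⟩
  rcases m' with r | l
  · exact (D.pos_add_dir rfl).symm
  · refine (D.pos_sub_dir ?_).symm
    simp only [target]
    rcases m with r | l'
    · simp only [visit] at hm'
      split at hm' <;> rename_i hx <;> simp at hx hm'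
      omega
    · simp only [visit] at hm'
      split at hm' <;> rename_i hx
      · split at hm' <;> simp at hm'
      · simp at hx; omega

/-- Particles of different teams may be adjacent, but only token holders send, and they send to
teammates. Injectivity of positions then identifies sender and addressee. -/
theorem sent_eq (h : Matches W blank start D port k₀ X c) (hN : 2 ≤ N)
    (active : Set (Fin k × Fin N)) (j : Fin k) (i : Fin N) (e : Fin 6) (x : R ⊕ L) :
    sent (W.algorithm blank start) port active c (j, i) e = some x ↔
    ∃ (a : Fin N) (m : R ⊕ L), (X j).2 = some ((a : ℕ), m) ∧ (j, a) ∈ active ∧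
      (W.visit (decide ((a : ℕ) = 0)) (decide ((a : ℕ) + 1 = N)) ((X j).1 a) m).2 = some x ∧
      (i : ℕ) = target a x ∧ e = arrival (D.dirn j) x := by
  unfold sent
  constructor
  · intro hs
    split at hs
    · rename_i hex
      obtain ⟨hq1, hq2⟩ := hex.choose_spec
      generalize hex.choose = q at hs hq1 hq2
      obtain ⟨j', a⟩ := q
      by_cases hh : Holds (X j') a
      · obtain ⟨m, hm⟩ := hh
        have hact := (h.act_of_holds hN hm).2 (e + 3)
        rw [hact, Option.bind_eq_some_iff] at hs
        obtain ⟨m', hm', hs⟩ := hs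
        split at hs
        · rename_i he
          simp only [Option.some.injEq] at hs
          subst hs
          obtain ⟨i₁, hi₁, hp⟩ := h.exists_target hN hm hm'
          rw [h.head, h.head] at hq2
          rw [hq2, ← he, dir_add_three, add_neg_cancel_right] at hp
          have := D.pos_injective hp
          simp only [Prod.mk.injEq] at this
          obtain ⟨rfl, rfl⟩ := this
          refine ⟨a, m, hm, hq1, hm', hi₁, ?_⟩
          rw [← fin_six_add_three e, he, heading_add_three]
        · simp at hs
      · rw [(h.act_of_not_holds hh).2] at hs
        simp at hs
    · simp at hs
  · rintro ⟨a, m, hm, ha, hx, hi, he⟩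
    obtain ⟨i₁, hi₁, hp⟩ := h.exists_target hN hm hx
    have : i₁ = i := Fin.ext (by rw [hi₁, hi])
    subst this
    have hpos : c.head (j, a) = c.head (j, i₁) + dir e := by
      rw [h.head, h.head, hp, he, ← heading_add_three, dir_add_three, add_neg_cancel_right]
    have hex : ∃ q ∈ active, c.head q = c.head (j, i₁) + dir e := ⟨(j, a), ha, hpos⟩
    rw [dif_pos hex]
    have hq : hex.choose = (j, a) := by
      have := hex.choose_spec.2.trans hpos.symm
      exact D.pos_injective ((h.head _).symm.trans (this.trans (h.head _)))
    rw [hq, (h.act_of_holds hN hm).2 (e + 3), hx, he, arrival_add_three]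
    simp

open Classical in
/-- A stage moves the tokens of the teams whose token holder is active. -/
theorem step (h : Matches W blank start D port k₀ X c) (hN : 2 ≤ N) {active : Set (Fin k × Fin N)}
    (hs : Step (W.algorithm blank start) port active c c') :
    Matches W blank start D port k₀ (fun j =>
      if ∀ i : Fin N, Holds (X j) i → (j, i) ∈ active then W.advance N (X j) else X j) c' := by
  obtain ⟨win, hw, -, hst, -, hnw, hin⟩ := hs
  -- All operations are `stay`, so nobody attempts an expansion.
  have hwin : ∀ p, p ∉ win := by
    intro p hp
    obtain ⟨v, -, -, ⟨i, hi, -⟩, -⟩ := hw p hp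
    have : (act (W.algorithm blank start) port c p).2.2 = .stay := W.next_stay blank start _ _ _
    rw [this] at hi
    simp at hi
  refine ⟨fun p => ?_, fun p => ?_, fun j i => ?_, fun j i e => ?_, fun j => ?_⟩
  · rw [(hnw p (hwin p)).1, h.head]
  · rw [(hnw p (hwin p)).2, h.tail]; simp
  · rw [hst]
    by_cases hh : Holds (X j) i
    · obtain ⟨m, hm⟩ := hh
      -- There is only one holder, so the guard just says that this particle is active.
      have hc : (∀ i : Fin N, Holds (X j) i → (j, i) ∈ active) ↔ (j, i) ∈ active := by
        refine ⟨fun h => h _ ⟨m, hm⟩, fun h i' hi' => ?_⟩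
        obtain ⟨m', hm'⟩ := hi'
        rw [hm] at hm'
        simp only [Option.some.injEq, Prod.mk.injEq] at hm'
        rwa [← Fin.ext hm'.1]
      simp only [hc]
      split
      · rw [(h.act_of_holds hN hm).1, cellState, if_neg]
        · rw [← Prod.mk.eta (p := X j), hm]
          simp [advance]
        · exact fun hx => not_waiting_advance N _ (by rw [hm]; rfl) hx.2
      · exact h.state j i
    · rw [(h.act_of_not_holds hh).1, ite_self, h.state]
      split
      · by_cases hn : (X j).2 = none
        · rw [advance_eq_self _ _ hn]
        · have hw' := not_waiting_advance (W := W) N (X j) (Option.isSome_iff_ne_none.2 hn)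
          have hw'' : ¬ ((i : ℕ) = 0 ∧ Waiting (X j)) := by
            rintro ⟨hi, r, hr⟩
            exact hh ⟨_, by rw [hr, hi]⟩
          rw [cellState, cellState, if_neg hw'', if_neg (fun hx => hw' hx.2)]
          obtain ⟨⟨a, m⟩, ham⟩ := Option.ne_none_iff_exists'.1 hn
          rw [← Prod.mk.eta (p := X j), ham]
          simp only [advance]
          rw [Function.update_of_ne]
          rintro rfl
          exact hh ⟨m, ham⟩
      · rfl
  · have hsent := h.sent_eq hN active j i e
    rw [hin, if_neg (hwin _)]
    by_cases hn : (X j).2 = none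
    · have h1 : sent (W.algorithm blank start) port active c (j, i) e = none := by
        rw [Option.eq_none_iff_forall_ne_some]
        intro x hx
        obtain ⟨a, m, hm, -⟩ := (hsent x).1 hx
        simp [hn] at hm
      rw [h1, advance_eq_self _ _ hn, ite_self, h.inbox, pending_of_not_holds]
      · simp
      · rintro ⟨m, hm⟩; simp [hn] at hm
    · obtain ⟨⟨a, m⟩, ham⟩ := Option.ne_none_iff_exists'.1 hn
      have haN := (h.valid j _ _ ham).1
      have hc : (∀ i : Fin N, Holds (X j) i → (j, i) ∈ active) ↔ (j, ⟨a, haN⟩) ∈ active := by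
        refine ⟨fun h => h _ ⟨m, ham⟩, fun h i' hi' => ?_⟩
        obtain ⟨m', hm'⟩ := hi'
        rw [ham] at hm'
        simp only [Option.some.injEq, Prod.mk.injEq] at hm'
        rwa [show i' = ⟨a, haN⟩ from Fin.ext hm'.1.symm]
      simp only [hc]
      by_cases ha : (j, ⟨a, haN⟩) ∈ active
      · rw [if_pos ha]
        have h1 : sent (W.algorithm blank start) port active c (j, i) e =
            pending (D.dirn j) (W.advance N (X j)) i e := by
          apply Option.ext
          intro x
          rw [hsent, pending, if_neg (not_waiting_advance N _ (by rw [ham]; rfl)),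
            ← Prod.mk.eta (p := X j), ham]
          simp only [advance, Option.bind_eq_some_iff, Option.map_eq_some_iff]
          constructor
          · rintro ⟨a', m', h1, h2, h3, h4, h5⟩
            simp only [Option.some.injEq, Prod.mk.injEq] at h1
            obtain ⟨rfl, rfl⟩ := h1
            exact ⟨_, ⟨x, h3, rfl⟩, by simp [h4, h5]⟩
          · rintro ⟨_, ⟨m', h1, rfl⟩, h2⟩
            simp only at h2
            split at h2
            · rename_i h3
              simp only [Option.some.injEq] at h2
              subst h2
              exact ⟨⟨a, haN⟩, m, rfl, ha, h1, h3⟩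
            · simp at h2
        rw [h1]
        split
        · rfl
        · rename_i hnone
          rw [Bool.not_eq_true, Option.isSome_eq_false_iff, Option.isNone_iff_eq_none] at hnone
          rw [hnone]
          split
          · rfl
          · rename_i hi
            rw [h.inbox, pending_of_not_holds]
            rintro ⟨m', hm'⟩
            rw [ham] at hm'
            simp only [Option.some.injEq, Prod.mk.injEq] at hm'
            apply hi
            rwa [show i = ⟨a, haN⟩ from Fin.ext hm'.1.symm]
      · rw [if_neg ha]
        have h1 : sent (W.algorithm blank start) port active c (j, i) e = none := by
          rw [Option.eq_none_iff_forall_ne_some]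
          intro x hx
          obtain ⟨a', m', hm, h2, -⟩ := (hsent x).1 hx
          rw [ham] at hm
          simp only [Option.some.injEq, Prod.mk.injEq] at hm
          apply ha
          rwa [show (⟨a, haN⟩ : Fin N) = a' from Fin.ext hm.1]
        rw [h1, h.inbox]
        simp only [Option.isSome_none, Bool.false_eq_true, if_false]
        split
        · rename_i hi
          rw [pending_of_not_holds]
          rintro ⟨m', hm'⟩
          rw [ham] at hm'
          simp only [Option.some.injEq, Prod.mk.injEq] at hm'
          apply ha
          rwa [show (⟨a, haN⟩ : Fin N) = i from Fin.ext hm'.1]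
        · rfl
  · split
    · exact Valid.advance W blank hN (h.valid j)
    · exact h.valid j

end Matches
end Sweeper

/-! ### Rounds and moves -/

/-- Fairness and finiteness make the set in the definition of `roundEnd` non-empty, so its infimum
is attained rather than being the default `0`. -/
theorem exists_active_in_round {P : Type} [Finite P] {active : ℕ → Set P} (h : Fair active) (r : ℕ)
    (p : P) : ∃ u, roundEnd active r ≤ u ∧ u < roundEnd active (r + 1) ∧ p ∈ active u := by
  have hne : {t | ∀ p, ∃ u, roundEnd active r ≤ u ∧ u < t ∧ p ∈ active u}.Nonempty := by
    choose u hu hu' using fun p => h p (roundEnd active r)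
    have : Nonempty (Fintype P) := ⟨Fintype.ofFinite P⟩
    obtain ⟨_⟩ := this
    exact ⟨Finset.univ.sup u + 1, fun p =>
      ⟨u p, hu p, Nat.lt_succ_of_le (Finset.le_sup (Finset.mem_univ p)), hu' p⟩⟩
  exact Nat.sInf_mem hne p

namespace Sweeper

variable {Γ R L : Type} (W : Sweeper Γ R L) (blank : Γ) (start : Fin 4 → R)

/-- The role assignment algorithm in which the token of each team, for `k` Leaders, starts as
`start k`, and the variables of a particle are read off from its cell. -/
abbrev roleAlgorithm [Finite Γ] [Finite R] [Finite L] (role : Γ → Option Element)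
    (double digit : Γ → Bool) (hrole : role blank = none) : RoleAlgorithm where
  toAlgorithm := W.algorithm blank start
  idle := .inr (false, blank)
  leader k i := .inl (Fin.ofNat 4 k, i)
  role := Sum.elim (fun _ => none) fun x => role x.2
  double := Sum.elim (fun _ => false) fun x => double x.2
  digit := Sum.elim (fun _ => false) fun x => digit x.2
  role_idle := hrole
  role_leader _ _ := rfl

/-- The line at the beginning. -/
def initialLine (k₀ : Fin 4) : Line Γ R L := (fun _ => blank, some (0, .inl (start k₀)))

section Run

variable [Finite Γ] [Finite R] [Finite L] {k N : ℕ} {D : Directrices k N}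
  {port : Fin k × Fin N → Ports} {role : Γ → Option Element} {double digit : Γ → Bool}
  {hrole : role blank = none} {active : ℕ → Set (Fin k × Fin N)}
  {c : ℕ → Config (Fin k × Fin N) (W.roleAlgorithm blank start role double digit hrole).Q
    (W.roleAlgorithm blank start role double digit hrole).M}

theorem matches_initial (hN : 2 ≤ N) :
    Matches W blank start D port (Fin.ofNat 4 k) (fun _ => initialLine blank start (Fin.ofNat 4 k))
      ((W.roleAlgorithm blank start role double digit hrole).initial D port) := by
  have hw : Waiting (initialLine (L := L) blank start (Fin.ofNat 4 k)) := ⟨_, rfl⟩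
  refine ⟨fun _ => rfl, fun _ => rfl, fun j i => ?_, fun j i e => ?_, fun j a m h => ?_⟩
  · simp only [RoleAlgorithm.initial, cellState, hw, and_true]
    split
    · rfl
    · rename_i h
      simp [initialLine, h]
  · simp only [RoleAlgorithm.initial, pending, if_pos hw]
  · simp only [initialLine, Option.some.injEq, Prod.mk.injEq] at h
    obtain ⟨rfl, rfl⟩ := h
    refine ⟨by omega, by simp, ?_⟩
    simp only [Sum.inl.injEq]
    rintro r rfl -
    exact ⟨rfl, rfl⟩

/-- In every round each team makes at least one move, until its token disappears. -/
theorem exists_moves (hN : 2 ≤ N) (hfair : Fair active)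
    (h0 : c 0 = (W.roleAlgorithm blank start role double digit hrole).initial D port)
    (hstep : ∀ t, Step (W.roleAlgorithm blank start role double digit hrole).toAlgorithm port
      (active t) (c t) (c (t + 1))) :
    ∃ T : ℕ → Fin k → ℕ, (∀ t, Matches W blank start D port (Fin.ofNat 4 k)
        (fun j => (W.advance N)^[T t j] (initialLine blank start (Fin.ofNat 4 k))) (c t)) ∧
      ∀ r j t, roundEnd active r ≤ t → r ≤ T t j := by
  classical
  let X : ℕ → Line Γ R L := fun n => (W.advance N)^[n] (initialLine blank start (Fin.ofNat 4 k))
  -- `T t j` counts the moves of team `j` before stage `t`. Teams proceed at different speeds along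
  -- the same deterministic run. Once the token is gone the guard is vacuous and idle moves are
  -- counted.
  let T : ℕ → Fin k → ℕ := fun t => Nat.rec (fun _ => 0) (fun t f j =>
    f j + if ∀ i : Fin N, Holds (X (f j)) i → (j, i) ∈ active t then 1 else 0) t
  have hT : ∀ t j, T (t + 1) j =
      T t j + if ∀ i : Fin N, Holds (X (T t j)) i → (j, i) ∈ active t then 1 else 0 :=
    fun _ _ => rfl
  have hmono : ∀ j, Monotone fun t => T t j := fun j =>
    monotone_nat_of_le_succ fun t => by rw [hT]; exact Nat.le_add_right _ _
  have hmatch : ∀ t, Matches W blank start D port (Fin.ofNat 4 k) (fun j => X (T t j)) (c t) := by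
    intro t
    induction t with
    | zero => rw [h0]; exact W.matches_initial blank start hN
    | succ t ih =>
      have := ih.step hN (hstep t)
      convert this using 2 with j
      rw [hT]
      split
      · exact Function.iterate_succ_apply' _ _ _
      · rfl
  refine ⟨T, hmatch, fun r j => ?_⟩
  induction r with
  | zero => exact fun _ _ => Nat.zero_le _
  | succ r ih =>
    intro t ht
    refine le_trans ?_ (hmono j ht)
    by_contra hlt
    -- If the round brought no move, the line would stay the same throughout it; but the holder of
    -- the token is active at some stage of the round.
    have hconst : ∀ u, roundEnd active r ≤ u → u ≤ roundEnd active (r + 1) → T u j = r := by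
      intro u hu hu'
      have h1 := ih u hu
      have h2 : T u j ≤ T (roundEnd active (r + 1)) j := hmono j hu'
      have h3 : ¬ r + 1 ≤ T (roundEnd active (r + 1)) j := hlt
      omega
    have hmove : ∃ u, roundEnd active r ≤ u ∧ u < roundEnd active (r + 1) ∧
        ∀ i : Fin N, Holds (X r) i → (j, i) ∈ active u := by
      by_cases hh : ∃ i : Fin N, Holds (X r) i
      · obtain ⟨i, m, hm⟩ := hh
        obtain ⟨u, h1, h2, h3⟩ := exists_active_in_round hfair r (j, i)
        refine ⟨u, h1, h2, ?_⟩
        rintro i' ⟨m', hm'⟩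
        rw [hm] at hm'
        simp only [Option.some.injEq, Prod.mk.injEq] at hm'
        rwa [← Fin.ext hm'.1]
      · obtain ⟨u, h1, h2, -⟩ := exists_active_in_round hfair r (j, ⟨0, by omega⟩)
        exact ⟨u, h1, h2, fun i hi => absurd ⟨i, hi⟩ hh⟩
    obtain ⟨u, h1, h2, h3⟩ := hmove
    have e1 := hconst u h1 h2.le
    have e2 := hconst (u + 1) (by omega) h2
    rw [hT, e1, if_pos h3] at e2
    omega

/-- A line without token is fixed by `advance`, so the count of moves may exceed `n` by different
amounts for different teams and stages. -/
theorem finished (hN : 2 ≤ N) (hfair : Fair active)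
    (h0 : c 0 = (W.roleAlgorithm blank start role double digit hrole).initial D port)
    (hstep : ∀ t, Step (W.roleAlgorithm blank start role double digit hrole).toAlgorithm port
      (active t) (c t) (c (t + 1))) {n : ℕ} {w : ℕ → Γ}
    (hn : (W.advance N)^[n] (initialLine blank start (Fin.ofNat 4 k)) = (w, none)) :
    (∀ t p, (c t).head p = D.pos p ∧ (c t).tail p = none) ∧
      ∀ t, roundEnd active n ≤ t → ∀ j (i : Fin N),
        (c t).state (j, i) = .inr (decide ((i : ℕ) = 0), w i) := by
  obtain ⟨T, h1, h2⟩ := W.exists_moves blank start hN hfair h0 hstep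
  refine ⟨fun t p => ⟨(h1 t).head p, (h1 t).tail p⟩, fun t ht j i => ?_⟩
  have hX : (W.advance N)^[T t j] (initialLine blank start (Fin.ofNat 4 k)) = (w, none) := by
    obtain ⟨m, hm⟩ := Nat.exists_eq_add_of_le' (h2 n j t ht)
    rw [hm, Function.iterate_add_apply, hn]
    exact Function.iterate_fixed rfl m
  rw [(h1 t).state j i, hX, cellState, if_neg]
  rintro ⟨-, r, hr⟩
  simp at hr

end Run

/-! ### Sweeps -/

variable {W}

/-- The cells beyond the first `N` ones are left blank. -/
def trim (N : ℕ) (w : ℕ → Γ) (j : ℕ) : Γ := if j < N then w j else blank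

/-- The Leader has just sent out the token `r`. -/
def departure (W : Sweeper Γ R L) (N : ℕ) (w : ℕ → Γ) (r : R) : Line Γ R L :=
  (Function.update (trim blank N w) 0 (W.right (w 0) r).1, some (1, .inl (W.right (w 0) r).2))

theorem advance_initialLine {N : ℕ} (hN : 2 ≤ N) (k₀ : Fin 4) :
    W.advance N (initialLine blank start k₀) = departure blank W N (fun _ => blank) (start k₀) := by
  have : ¬ (0 + 1 = N) := by omega
  have h2 : trim blank N (fun _ => blank) = fun _ => blank := by
    funext j; simp [trim]
  simp [initialLine, advance, departure, visit, this, target, h2]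

variable {N : ℕ} {w w' w'' : ℕ → Γ} {ρ : ℕ → R} {l : ℕ → L}

theorem advance_right_pass (hr : ∀ j < N, W.right (w j) (ρ j) = (w' j, ρ (j + 1))) (n : ℕ)
    (hn : n + 1 < N) : (W.advance N)^[n] (departure blank W N w (ρ 0)) =
      (trim blank N (fun j => if j < n + 1 then w' j else w j), some (n + 1, .inl (ρ (n + 1)))) := by
  induction n with
  | zero =>
    simp only [Function.iterate_zero, id, departure, hr 0 (by omega), Prod.mk.injEq, and_true]
    funext j
    by_cases hj : j = 0
    · subst hj
      simp [trim]; omega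
    · simp [trim, hj]
  | succ n ih =>
    rw [Function.iterate_succ_apply', ih (by omega)]
    have h1 : ¬ (n + 1 + 1 = N) := by omega
    have h2 : trim blank N (fun j => if j < n + 1 then w' j else w j) (n + 1) = w (n + 1) := by
      simp [trim]; omega
    simp only [advance, visit, h1, h2, decide_false, Bool.false_eq_true, if_false,
      hr (n + 1) (by omega), Option.map_some, target, Prod.mk.injEq, and_true]
    funext j
    by_cases hj : j = n + 1
    · subst hj
      simp [trim]; omega
    · rw [Function.update_of_ne hj]
      have : j < n + 1 ↔ j < n + 1 + 1 := by omega
      simp [trim, this]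

theorem advance_left_pass (hl : ∀ j < N, W.left (w' j) (l (j + 1)) = (w'' j, l j)) (n a : ℕ)
    (hn : n + a + 1 < N) : (W.advance N)^[n] (trim blank N (fun j => if j < n + a + 1 then w' j else w'' j),
        some (n + a, .inr (l (n + a + 1)))) =
      (trim blank N (fun j => if j < a + 1 then w' j else w'' j), some (a, .inr (l (a + 1)))) := by
  induction n with
  | zero => simp
  | succ n ih =>
    rw [Function.iterate_succ_apply, ← ih (by omega)]
    congr 1
    have h1 : ¬ (n + 1 + a = 0) := by omega
    have h2 : trim blank N (fun j => if j < n + 1 + a + 1 then w' j else w'' j) (n + 1 + a) =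
        w' (n + 1 + a) := by
      simp [trim]; omega
    have h3 : n + 1 + a - 1 = n + a := by omega
    have h4 : n + 1 + a = n + a + 1 := by omega
    simp only [advance, visit, h1, h2, decide_false, Bool.false_eq_true, if_false,
      hl (n + 1 + a) (by omega), Option.map_some, target, Prod.mk.injEq, h3]
    refine ⟨?_, by rw [h4]⟩
    funext j
    by_cases hj : j = n + 1 + a
    · subst hj
      simp [trim]; omega
    · rw [Function.update_of_ne hj]
      have : j < n + 1 + a + 1 ↔ j < n + a + 1 := by omega
      simp [trim, this]

/-- One sweep of the token over the line takes `2 * (N - 1)` moves. -/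
theorem advance_sweep (hN : 2 ≤ N) (hr : ∀ j < N, W.right (w j) (ρ j) = (w' j, ρ (j + 1)))
    (ht : W.turn (ρ N) = l N) (hl : ∀ j < N, W.left (w' j) (l (j + 1)) = (w'' j, l j)) :
    (W.advance N)^[2 * (N - 1)] (departure blank W N w (ρ 0)) =
      match W.ctrl (l 0) with
      | none => (trim blank N w'', none)
      | some r => departure blank W N w'' r := by
  obtain ⟨n, rfl⟩ := Nat.exists_eq_add_of_le' hN
  have h1 := advance_right_pass blank hr n (by omega)
  have h2 := advance_left_pass blank hl n 0 (by omega)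
  -- From right to left, as the iterates are applied: `n` moves outward over the cells `1, …, n`,
  -- the turn at cell `n + 1`, `n` moves back to cell `0`, and the visit of the Leader.
  have hcount : 2 * (n + 2 - 1) = 1 + (n + (1 + n)) := by omega
  rw [hcount, Function.iterate_add_apply, Function.iterate_add_apply, Function.iterate_add_apply, h1]
  simp only [add_zero] at h2
  have hturn : (W.advance (n + 2))^[1] (trim blank (n + 2) (fun j => if j < n + 1 then w' j else w j),
      some (n + 1, .inl (ρ (n + 1)))) =
      (trim blank (n + 2) (fun j => if j < n + 1 then w' j else w'' j), some (n, .inr (l (n + 1)))) := by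
    have h3 : trim blank (n + 2) (fun j => if j < n + 1 then w' j else w j) (n + 1) = w (n + 1) := by
      simp [trim]
    have h4 : n + 1 + 1 = n + 2 := rfl
    have h5 := hl (n + 1) (by omega)
    rw [h4, ← ht] at h5
    simp only [Function.iterate_one, advance, visit, h3, h4, decide_true, if_true,
      hr (n + 1) (by omega), h5, Option.map_some, target, Prod.mk.injEq]
    refine ⟨?_, rfl⟩
    funext j
    by_cases hj : j = n + 1
    · subst hj
      simp [trim]
    · rw [Function.update_of_ne hj]
      by_cases hj' : j < n + 1
      · simp [trim, hj']
      · have : ¬ j < n + 2 := by omega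
        simp [trim, this]
  rw [hturn, h2]
  have h6 : trim blank (n + 2) (fun j => if j < 0 + 1 then w' j else w'' j) 0 = w' 0 := by
    simp [trim]
  have h7 : ∀ x, Function.update (trim blank (n + 2) (fun j => if j < 0 + 1 then w' j else w'' j)) 0 x
      = Function.update (trim blank (n + 2) w'') 0 x := by
    intro x
    funext j
    by_cases hj : j = 0
    · subst hj; simp
    · rw [Function.update_of_ne hj, Function.update_of_ne hj]
      simp [trim, hj]
  have h8 : Function.update (trim blank (n + 2) w'') 0 (w'' 0) = trim blank (n + 2) w'' := by
    rw [Function.update_eq_self_iff]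
    simp [trim]
  have h9 := hl 0 (by omega)
  simp only [Function.iterate_one, advance, visit, h6, decide_true, if_true, h9]
  cases hc : W.ctrl (l 0) with
  | none => simp only [Option.map_none, h7, h8]
  | some r => simp only [h7, Option.map_some, target, departure]

end Sweeper

/-! ## A machine that counts in unary -/

/-- The kinds of sweeps. -/
inductive Phase where
  | first
  | inner
  | outer
  deriving DecidableEq

instance : Finite Phase :=
  Finite.of_surjective (fun n : Fin 3 => (![Phase.first, .inner, .outer] n : Phase)) fun p => by
    cases p
    · exact ⟨0, rfl⟩
    · exact ⟨1, rfl⟩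
    · exact ⟨2, rfl⟩

/-- The number that is added to the scale in a sweep. -/
def Phase.scale : Phase → ℕ
  | first => 7
  | inner => 0
  | outer => 6

theorem Phase.scale_lt (ph : Phase) : ph.scale < 8 := by cases ph <;> simp [Phase.scale]

/-- A cell with one flag for each counter. A counter with value `x` is stored by raising its flag in
the first `x` cells. -/
@[ext] structure Cell (ι : Type) where
  flag : ι → Bool
  double : Bool
  digit : Bool
  par : Fin 4

@[ext] structure RToken (ι : Type) (b : ℕ) where
  par : Fin 4
  phase : Phase
  carry : ι → Fin (b + 1)
  digitCarry : Fin 8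

@[ext] structure LToken (b : ℕ) where
  par : Fin 4
  phase : Phase
  excess : Fin (b + 1)
  pend : Bool
  short : Bool

instance (ι : Type) [Finite ι] : Finite (Cell ι) :=
  Finite.of_injective (fun g => (g.flag, g.double, g.digit, g.par)) fun a b h => by
    simp only [Prod.mk.injEq] at h
    exact Cell.ext h.1 h.2.1 h.2.2.1 h.2.2.2

instance (ι : Type) [Finite ι] (b : ℕ) : Finite (RToken ι b) :=
  Finite.of_injective (fun g => (g.par, g.phase, g.carry, g.digitCarry)) fun a b h => by
    simp only [Prod.mk.injEq] at h
    exact RToken.ext h.1 h.2.1 h.2.2.1 h.2.2.2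

instance (b : ℕ) : Finite (LToken b) :=
  Finite.of_injective (fun g => (g.par, g.phase, g.excess, g.pend, g.short)) fun a b h => by
    simp only [Prod.mk.injEq] at h
    exact LToken.ext h.1 h.2.1 h.2.2.1 h.2.2.2.1 h.2.2.2.2

def putFlag {b : ℕ} (f : Bool) (c : Fin (b + 1)) : Bool := f || decide (0 < (c : ℕ))

def putCarry {b : ℕ} (f : Bool) (c : Fin (b + 1)) : Fin (b + 1) :=
  if f then c else ⟨c - 1, by omega⟩

/-- To add `c` to a unary counter with value `B`, the token drops one unit in each cell without
flag. On arrival at cell `j` it still carries `min c (B + c - j)`: all of `c` up to cell `B`, then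
one less per cell. -/
theorem putFlag_fill {b B c j : ℕ} (h : min c (B + c - j) < b + 1) :
    putFlag (decide (j < B)) (⟨min c (B + c - j), h⟩ : Fin (b + 1)) = decide (j < B + c) := by
  unfold putFlag
  rw [← Bool.decide_or, decide_eq_decide]
  simp only
  omega

theorem putCarry_fill {b B c j : ℕ} (h : min c (B + c - j) < b + 1)
    (h' : min c (B + c - (j + 1)) < b + 1) :
    putCarry (decide (j < B)) (⟨min c (B + c - j), h⟩ : Fin (b + 1)) =
      ⟨min c (B + c - (j + 1)), h'⟩ := by
  unfold putCarry
  simp only [decide_eq_true_eq]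
  split <;> (apply Fin.ext; simp only; omega)

theorem digit_carry_lt (v a j : ℕ) (ha : a < 8) : (v % 2 ^ j + a) / 2 ^ j < 8 := by
  have h := Nat.mod_lt v (Nat.two_pow_pos j)
  rw [Nat.div_lt_iff_lt_mul (Nat.two_pow_pos j)]
  nlinarith [Nat.two_pow_pos j]

/-- When `a` is added to `v` with the whole of `a` as initial carry, the carry into position `j` is
`(v % 2 ^ j + a) / 2 ^ j`. -/
theorem digit_sum (v a j : ℕ) : (v.testBit j).toNat + (v % 2 ^ j + a) / 2 ^ j =
    (v % 2 ^ (j + 1) + a) / 2 ^ j := by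
  have h : v % 2 ^ (j + 1) = v % 2 ^ j + 2 ^ j * (v.testBit j).toNat := by
    rw [Nat.mod_pow_succ, Nat.testBit_eq_decide_div_mod_eq]
    rcases Nat.mod_two_eq_zero_or_one (v / 2 ^ j) with h | h <;> simp [h]
  rw [h, Nat.add_right_comm, Nat.add_mul_div_left _ _ (Nat.two_pow_pos j), add_comm]

theorem digit_add (v a j : ℕ) :
    decide (((v.testBit j).toNat + (v % 2 ^ j + a) / 2 ^ j) % 2 = 1) = (v + a).testBit j := by
  rw [digit_sum, Nat.testBit_eq_decide_div_mod_eq, decide_eq_decide]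
  have h : v + a = (v % 2 ^ (j + 1) + a) + 2 ^ j * (2 * (v / 2 ^ (j + 1))) := by
    have := Nat.div_add_mod v (2 ^ (j + 1))
    rw [pow_succ] at this ⊢
    nlinarith
  rw [h, Nat.add_mul_div_left _ _ (Nat.two_pow_pos j), Nat.add_mul_mod_self_left]

theorem digit_carry_succ (v a j : ℕ) :
    ((v.testBit j).toNat + (v % 2 ^ j + a) / 2 ^ j) / 2 = (v % 2 ^ (j + 1) + a) / 2 ^ (j + 1) := by
  rw [digit_sum, Nat.div_div_eq_div_mul, ← pow_succ]

section Counter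

variable {ι : Type} [DecidableEq ι] {b : ℕ} (inc : Fin 4 → Phase → ι → Fin (b + 1)) (qi ji li : ι)

/-- The token that starts a sweep. -/
def emit (k : Fin 4) (ph : Phase) : RToken ι b := ⟨k, ph, inc k ph, ⟨ph.scale, ph.scale_lt⟩⟩

/-- The counting machine. A sweep increases the counter `i` by `inc k ph i`; the counter `ji` is
reset in all sweeps but those of phase `inner`. Sweeps of phase `inner` are done while `ji` is less
than `qi`. The machine halts when the counter `li` has reached the end of the line after a sweep of
another phase; its overflow is stored from the right as flag `double`. -/
def counter : Sweeper (Cell ι) (RToken ι b) (LToken b) where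
  right g r := (⟨fun i => putFlag (g.flag i) (r.carry i), g.double,
      decide ((g.digit.toNat + r.digitCarry) % 2 = 1), r.par⟩,
    ⟨r.par, r.phase, fun i => putCarry (g.flag i) (r.carry i),
      ⟨(g.digit.toNat + r.digitCarry) / 2, by have := g.digit.toNat_le; omega⟩⟩)
  turn r := ⟨r.par, r.phase, r.carry li, false, false⟩
  left g l := (⟨fun i => if i = ji ∧ l.phase ≠ .inner then false else g.flag i,
      putFlag g.double l.excess, g.digit, g.par⟩,
    ⟨l.par, l.phase, putCarry g.double l.excess,
      l.pend || (g.flag qi && !(if l.phase ≠ .inner then false else g.flag ji)),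
      l.short || !g.flag li⟩)
  ctrl l := if l.phase ≠ .inner ∧ l.short = false then none
    else some (emit inc l.par (if l.pend then .inner else .outer))

/-- The cells that store the values `B` of the counters and the scale `v`. -/
def tape (N : ℕ) (k : Fin 4) (B : ι → ℕ) (v : ℕ) (j : ℕ) : Cell ι where
  flag i := decide (j < B i)
  double := decide (N ≤ j + (B li - N))
  digit := v.testBit j
  par := k

def blankCell (ι : Type) : Cell ι := ⟨fun _ => false, false, false, 0⟩

/-- The values of the counters after a sweep. -/
def bump (k : Fin 4) (ph : Phase) (B : ι → ℕ) (i : ι) : ℕ :=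
  if i = ji ∧ ph ≠ .inner then 0 else B i + inc k ph i

variable {qi ji li}

-- `B` holds the true values of the counters, possibly beyond `N`; flags show them cut off at `N`.
-- For the last counter nothing is lost: what cannot be placed on the way out is placed on the way
-- back as `double` flags. The decision at the Leader uses the disjunctions over all cells collected
-- by `pend` and `short`.
open Classical in
theorem counter_sweep (hq : qi ≠ ji) (hl : li ≠ ji) {N : ℕ} (hN : 2 ≤ N) (p k : Fin 4) (ph : Phase)
    (B : ι → ℕ) (v : ℕ) :
    ((counter inc qi ji li).advance N)^[2 * (N - 1)] (Sweeper.departure (blankCell ι)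
        (counter inc qi ji li) N (tape li N p B v) (emit inc k ph)) =
      if ph ≠ .inner ∧ N ≤ bump inc ji k ph B li then
        (Sweeper.trim (blankCell ι) N (tape li N k (bump inc ji k ph B) (v + ph.scale)), none)
      else Sweeper.departure (blankCell ι) (counter inc qi ji li) N
        (tape li N k (bump inc ji k ph B) (v + ph.scale)) (emit inc k
          (if bump inc ji k ph B ji < min N (bump inc ji k ph B qi) then .inner else .outer)) := by
  set B' := bump inc ji k ph B with hB'
  have hb : ∀ i, (inc k ph i : ℕ) < b + 1 := fun i => (inc k ph i).2
  have hBli : B' li = B li + inc k ph li := by simp [hB', bump, hl]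
  have hBqi : B' qi = B qi + inc k ph qi := by simp [hB', bump, hq]
  let ρ : ℕ → RToken ι b := fun j => ⟨k, ph,
    fun i => ⟨min (inc k ph i) (B i + inc k ph i - j), lt_of_le_of_lt (min_le_left _ _) (hb i)⟩,
    ⟨(v % 2 ^ j + ph.scale) / 2 ^ j, digit_carry_lt _ _ _ ph.scale_lt⟩⟩
  let w' : ℕ → Cell ι := fun j => ⟨fun i => decide (j < B i + inc k ph i),
    decide (N ≤ j + (B li - N)), (v + ph.scale).testBit j, k⟩
  -- The part of the increment of the last counter that remains at the end of the line.
  let c₀ := min (inc k ph li : ℕ) (B li + inc k ph li - N)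
  let l : ℕ → LToken b := fun j => ⟨k, ph,
    ⟨min c₀ ((B li - N) + c₀ - (N - j)), lt_of_le_of_lt (min_le_left _ _)
      (lt_of_le_of_lt (min_le_left _ _) (hb li))⟩,
    decide (∃ x, j ≤ x ∧ x < N ∧ x < B' qi ∧ ¬ x < B' ji),
    decide (∃ x, j ≤ x ∧ x < N ∧ ¬ x < B' li)⟩
  have key := Sweeper.advance_sweep (W := counter inc qi ji li) (blankCell ι) (w := tape li N p B v)
    (w' := w') (w'' := tape li N k B' (v + ph.scale)) (ρ := ρ) (l := l) hN ?_ ?_ ?_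
  · have hρ : ρ 0 = emit inc k ph := by
      simp only [ρ, emit]
      congr 1
      · funext i
        apply Fin.ext
        simp
      · apply Fin.ext
        simp [Nat.mod_one]
    rw [hρ] at key
    rw [key]
    have hctrl : (counter inc qi ji li).ctrl (l 0) = if ph ≠ .inner ∧ N ≤ B' li then none
        else some (emit inc k (if B' ji < min N (B' qi) then .inner else .outer)) := by
      simp only [counter, l, decide_eq_false_iff_not, decide_eq_true_eq]
      have h1 : (¬ ∃ x, 0 ≤ x ∧ x < N ∧ ¬ x < B' li) ↔ N ≤ B' li := by
        constructor
        · intro h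
          by_contra hlt
          exact h ⟨B' li, by omega, by omega, by omega⟩
        · rintro h ⟨x, hx⟩
          omega
      have h2 : (∃ x, 0 ≤ x ∧ x < N ∧ x < B' qi ∧ ¬ x < B' ji) ↔ B' ji < min N (B' qi) := by
        constructor
        · rintro ⟨x, hx⟩
          omega
        · intro h
          exact ⟨B' ji, by omega⟩
      simp only [h1, h2]
    rw [hctrl]
    split_ifs <;> rfl
  · intro j _
    simp only [counter, tape, ρ, w', Prod.mk.injEq, Cell.mk.injEq, RToken.mk.injEq, true_and,
      and_true]
    refine ⟨⟨?_, digit_add _ _ _⟩, ?_, Fin.ext (digit_carry_succ _ _ _)⟩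
    · funext i
      exact putFlag_fill _
    · funext i
      exact putCarry_fill _ _
  · simp only [counter, ρ, l, LToken.mk.injEq, true_and]
    refine ⟨Fin.ext ?_, ?_, ?_⟩
    · simp only [c₀]; omega
    · symm
      rw [decide_eq_false_iff_not]
      rintro ⟨x, hx⟩
      omega
    · symm
      rw [decide_eq_false_iff_not]
      rintro ⟨x, hx⟩
      omega
  · intro j hj
    -- Seen from the far end, the `double` flags form a unary counter with value `B li - N`, so the
    -- lemmas on filling apply again.
    have hd : decide (N ≤ j + (B li - N)) = decide (N - 1 - j < B li - N) := by
      rw [decide_eq_decide]; omega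
    have hd' : N - (j + 1) = N - 1 - j := by omega
    have hd'' : N - j = N - 1 - j + 1 := by omega
    simp only [counter, tape, w', l, Prod.mk.injEq, Cell.mk.injEq, LToken.mk.injEq, true_and,
      and_true, hd, hd', hd'']
    refine ⟨⟨?_, ?_⟩, putCarry_fill _ _, ?_, ?_⟩
    · funext i
      simp only [hB', bump]
      split_ifs <;> simp
    · rw [putFlag_fill, decide_eq_decide, hBli]
      simp only [c₀]
      omega
    · have : (if ph ≠ .inner then false else decide (j < B ji + inc k ph ji)) = decide (j < B' ji) := by
        simp only [hB', bump, true_and]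
        split_ifs <;> simp
      rw [this, ← hBqi, ← decide_not, ← Bool.decide_and, ← Bool.decide_or, decide_eq_decide]
      constructor
      · rintro (⟨x, hx⟩ | hx)
        · exact ⟨x, by omega⟩
        · exact ⟨j, by omega⟩
      · rintro ⟨x, hx⟩
        by_cases hxj : x = j
        · subst hxj; right; omega
        · left; exact ⟨x, by omega⟩
    · rw [← hBli, ← decide_not, ← Bool.decide_or, decide_eq_decide]
      constructor
      · rintro (⟨x, hx⟩ | hx)
        · exact ⟨x, by omega⟩
        · exact ⟨j, by omega⟩
      · rintro ⟨x, hx⟩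
        by_cases hxj : x = j
        · subst hxj; right; omega
        · left; exact ⟨x, by omega⟩

end Counter

/-! ### Nested loops of the counting machine -/

section Counter

variable {ι : Type} [DecidableEq ι] {b : ℕ} (inc : Fin 4 → Phase → ι → Fin (b + 1)) (qi ji li : ι)

/-- The values of the counters after the first sweep and `q` executions of the outer loop. -/
def loopValue (k : Fin 4) : ℕ → ι → ℕ
  | 0 => bump inc ji k .first fun _ => 0
  | q + 1 => bump inc ji k .outer fun i =>
      loopValue k q i + loopValue k q qi * inc k .inner i

open Classical in
/-- The line after the first sweep and `q` executions of the outer loop. -/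
def loopLine (N : ℕ) (k : Fin 4) (q : ℕ) : Sweeper.Line (Cell ι) (RToken ι b) (LToken b) :=
  if N ≤ loopValue inc qi ji k q li then
    (Sweeper.trim (blankCell ι) N (tape li N k (loopValue inc qi ji k q) (6 * q + 7)), none)
  else Sweeper.departure (blankCell ι) (counter inc qi ji li) N
    (tape li N k (loopValue inc qi ji k q) (6 * q + 7))
    (emit inc k (if 0 < min N (loopValue inc qi ji k q qi) then .inner else .outer))

theorem loopValue_inner (k : Fin 4) (q : ℕ) : loopValue inc qi ji k q ji = 0 := by
  cases q <;> simp [loopValue, bump]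

variable {qi ji li} {N : ℕ} {k : Fin 4}

theorem first_sweep (hq : qi ≠ ji) (hl : li ≠ ji) (hN : 2 ≤ N) (k : Fin 4) :
    ((counter inc qi ji li).advance N)^[2 * (N - 1) + 1]
      (Sweeper.initialLine (blankCell ι) (fun k => emit inc k .first) k) =
      loopLine inc qi ji li N k 0 := by
  rw [Function.iterate_succ_apply, Sweeper.advance_initialLine _ _ hN]
  -- Within the line, the blank cells form the tape of zero counters with parameter `0`; the first
  -- sweep overwrites the parameter by `k`.
  have h : Sweeper.departure (blankCell ι) (counter inc qi ji li) N (fun _ => blankCell ι)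
      (emit inc k .first) = Sweeper.departure (blankCell ι) (counter inc qi ji li) N
        (tape li N 0 (fun _ => 0) 0) (emit inc k .first) := by
    have h0 : ∀ j < N, tape li N 0 (fun _ => 0) 0 j = blankCell ι := by
      intro j hj
      simp only [tape, blankCell, Cell.mk.injEq]
      refine ⟨by simp, ?_, by simp, trivial⟩
      rw [decide_eq_false_iff_not]
      omega
    have h1 : Sweeper.trim (blankCell ι) N (tape li N 0 (fun _ => 0) 0) =
        Sweeper.trim (blankCell ι) N fun _ => blankCell ι := by
      funext j
      unfold Sweeper.trim
      split
      · rename_i hj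
        rw [h0 j hj]
      · rfl
    unfold Sweeper.departure
    rw [h1, h0 0 (by omega)]
  rw [h, counter_sweep inc hq hl hN]
  unfold loopLine
  simp only [ne_eq, reduceCtorEq, not_false_eq_true, true_and]
  have h0 : bump inc ji k .first (fun _ => 0) = loopValue inc qi ji k 0 := rfl
  simp only [h0, loopValue_inner, Phase.scale]

/-- After `j` inner sweeps the counter `ji` equals `j` while `qi` is unchanged, so their comparison
stops the loop after exactly `B qi` sweeps. The bound `B qi ≤ N` ensures that the flags show `qi`
without cutoff. -/
theorem inner_sweeps (hq : qi ≠ ji) (hl : li ≠ ji) (hN : 2 ≤ N)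
    (hiq : (inc k .inner qi : ℕ) = 0) (hij : (inc k .inner ji : ℕ) = 1) {B : ι → ℕ} (hB : B ji = 0)
    (hBq : B qi ≤ N) (v j : ℕ) (hj : j ≤ B qi) :
    ((counter inc qi ji li).advance N)^[2 * (N - 1) * j]
      (Sweeper.departure (blankCell ι) (counter inc qi ji li) N (tape li N k B v)
        (emit inc k (if 0 < B qi then .inner else .outer))) =
      Sweeper.departure (blankCell ι) (counter inc qi ji li) N
        (tape li N k (fun i => B i + j * inc k .inner i) v)
        (emit inc k (if j < B qi then .inner else .outer)) := by
  induction j with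
  | zero => simp
  | succ j ih =>
    rw [Nat.mul_succ, add_comm, Function.iterate_add_apply, ih (by omega), if_pos (by omega),
      counter_sweep inc hq hl hN, if_neg (by simp)]
    have h1 : bump inc ji k .inner (fun i => B i + j * (inc k .inner i : ℕ)) =
        fun i => B i + (j + 1) * (inc k .inner i : ℕ) := by
      funext i
      simp only [bump, ne_eq, not_true_eq_false, and_false, if_false]
      ring
    rw [h1]
    have h2 : B ji + (j + 1) * (inc k .inner ji : ℕ) < min N (B qi + (j + 1) * inc k .inner qi) ↔
        j + 1 < B qi := by
      rw [hB, hiq, hij]; omega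
    simp only [h2, Phase.scale, add_zero]

theorem outer_sweep (hq : qi ≠ ji) (hl : li ≠ ji) (hN : 2 ≤ N)
    (hiq : (inc k .inner qi : ℕ) = 0) (hij : (inc k .inner ji : ℕ) = 1) {q : ℕ}
    (hq1 : loopValue inc qi ji k q li < N) (hq2 : loopValue inc qi ji k q qi ≤ N) :
    ((counter inc qi ji li).advance N)^[2 * (N - 1) * (loopValue inc qi ji k q qi + 1)]
      (loopLine inc qi ji li N k q) = loopLine inc qi ji li N k (q + 1) := by
  rw [loopLine, if_neg (by omega), min_eq_right hq2, Nat.mul_succ, add_comm,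
    Function.iterate_add_apply,
    inner_sweeps inc hq hl hN hiq hij (loopValue_inner inc qi ji k q) hq2 _ _ le_rfl,
    if_neg (lt_irrefl _), counter_sweep inc hq hl hN]
  unfold loopLine
  simp only [ne_eq, reduceCtorEq, not_false_eq_true, true_and]
  have h0 : bump inc ji k .outer (fun i =>
      loopValue inc qi ji k q i + loopValue inc qi ji k q qi * (inc k .inner i : ℕ)) =
      loopValue inc qi ji k (q + 1) := rfl
  simp only [h0, loopValue_inner]
  have : 6 * q + 7 + Phase.outer.scale = 6 * (q + 1) + 7 := by simp [Phase.scale]; omega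
  rw [this]

/-- The machine halts after the first execution of the outer loop in which the last counter has
reached the end of the line. -/
theorem counter_halts (hq : qi ≠ ji) (hl : li ≠ ji) (hN : 2 ≤ N)
    (hiq : (inc k .inner qi : ℕ) = 0) (hij : (inc k .inner ji : ℕ) = 1) {q : ℕ}
    (hlt : ∀ q' < q, loopValue inc qi ji k q' li < N ∧ loopValue inc qi ji k q' qi ≤ N)
    (hle : N ≤ loopValue inc qi ji k q li) :
    ((counter inc qi ji li).advance N)^[2 * (N - 1) * (1 + ∑ q' ∈ Finset.range q,
        (loopValue inc qi ji k q' qi + 1)) + 1]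
      (Sweeper.initialLine (blankCell ι) (fun k => emit inc k .first) k) =
      (Sweeper.trim (blankCell ι) N (tape li N k (loopValue inc qi ji k q) (6 * q + 7)), none) := by
  have h : ∀ n ≤ q, ((counter inc qi ji li).advance N)^[2 * (N - 1) * (1 + ∑ q' ∈ Finset.range n,
        (loopValue inc qi ji k q' qi + 1)) + 1]
      (Sweeper.initialLine (blankCell ι) (fun k => emit inc k .first) k) =
      loopLine inc qi ji li N k n := by
    intro n
    induction n with
    | zero =>
      intro _
      rw [Finset.range_zero, Finset.sum_empty, add_zero, mul_one]
      exact first_sweep inc hq hl hN k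
    | succ n ih =>
      intro hn
      rw [Finset.sum_range_succ, ← add_assoc, Nat.mul_add, add_right_comm, add_comm,
        Function.iterate_add_apply, ih (by omega)]
      exact outer_sweep inc hq hl hN hiq hij (hlt n hn).1 (hlt n hn).2
  rw [h q le_rfl, loopLine, if_pos hle]

end Counter

/-! ## Rotations and cells -/

theorem rot60_injective : Function.Injective rot60 := by
  rintro ⟨a, b⟩ ⟨c, d⟩ h
  simp only [rot60, Prod.mk.injEq, neg_inj] at h
  obtain ⟨rfl, h⟩ := h
  simpa using h

theorem gridRotation_injective (k : ℕ) (s : Vertex) : Function.Injective (gridRotation k s) :=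
  fun _ _ h => rot60_injective.iterate _ (add_right_cancel h)

theorem gridRotation_one (v : Vertex) : gridRotation 1 0 v = v := by
  simp [gridRotation, rot60]

theorem gridRotation_two (s v : Vertex) : gridRotation 2 s v = s - v := by
  simp [gridRotation, rot60, Prod.ext_iff]
  constructor <;> ring

theorem gridRotation_three (s v : Vertex) :
    gridRotation 3 s v = (s.1 - v.1 - v.2, s.2 + v.1) := by
  simp [gridRotation, rot60, Prod.ext_iff]
  constructor <;> ring

theorem gridRotation_iterate {k : ℕ} {s : Vertex} (h : (k = 1 ∧ s = 0) ∨ k = 2 ∨ k = 3) :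
    (gridRotation k s)^[k] = id := by
  funext v
  rcases h with ⟨rfl, rfl⟩ | rfl | rfl
  · simp [gridRotation_one]
  · simp [gridRotation_two]
  · simp only [Function.iterate_succ, Function.iterate_zero, Function.comp_apply, id,
      gridRotation_three, Prod.ext_iff]
    constructor <;> ring

theorem dir_triangle : ∀ i j : Fin 6, (∃ d, dir j = dir i + dir d) → j = i + 1 ∨ i = j + 1 := by
  unfold dir; decide

/-- There are no three pairwise consecutive directions modulo 6; hence at a given vertex the only
cells are the vertex, six edges and six faces. -/
theorem direction_sets : ∀ E : Finset (Fin 6),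
    (∀ i ∈ E, ∀ j ∈ E, i ≠ j → j = i + 1 ∨ i = j + 1) →
      E = ∅ ∨ ∃ d, E = {d} ∨ E = {d, d + 1} := by
  decide

/-- The cells of the grid. -/
theorem cell_cases {σ : Finset Vertex} (hσ : ∀ u ∈ σ, ∀ v ∈ σ, u ≠ v → Adj u v) {v : Vertex}
    (hv : v ∈ σ) : σ = {v} ∨ ∃ d, σ = {v, v + dir d} ∨ σ = {v, v + dir d, v + dir (d + 1)} := by
  let E : Finset (Fin 6) := Finset.univ.filter fun d => v + dir d ∈ σ
  have hE : σ = insert v (E.image fun d => v + dir d) := by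
    ext u
    simp only [E, Finset.mem_insert, Finset.mem_image, Finset.mem_filter, Finset.mem_univ, true_and]
    constructor
    · intro hu
      by_cases huv : u = v
      · exact Or.inl huv
      · obtain ⟨d, rfl⟩ := hσ v hv u hu (Ne.symm huv)
        exact Or.inr ⟨d, hu, rfl⟩
    · rintro (rfl | ⟨d, hd, rfl⟩)
      · exact hv
      · exact hd
  have hpair : ∀ i ∈ E, ∀ j ∈ E, i ≠ j → j = i + 1 ∨ i = j + 1 := by
    intro i hi j hj hij
    simp only [E, Finset.mem_filter, Finset.mem_univ, true_and] at hi hj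
    apply dir_triangle
    obtain ⟨d, hd⟩ := hσ _ hi _ hj fun h => hij (dir_injective (add_left_cancel h))
    exact ⟨d, by rw [add_assoc] at hd; exact add_left_cancel hd⟩
  rcases direction_sets E hpair with h | ⟨d, h | h⟩
  · left; rw [hE, h]; rfl
  · right; exact ⟨d, Or.inl (by rw [hE, h]; simp)⟩
  · right; exact ⟨d, Or.inr (by rw [hE, h]; simp [Finset.image_insert])⟩

theorem cell_card_le {σ : Finset Vertex} (hσ : ∀ u ∈ σ, ∀ v ∈ σ, u ≠ v → Adj u v) :
    σ.card ≤ 3 := by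
  rcases σ.eq_empty_or_nonempty with rfl | ⟨v, hv⟩
  · simp
  · rcases cell_cases hσ hv with h | ⟨d, h | h⟩
    · rw [h]; simp
    · rw [h]; exact Finset.card_le_two.trans (by norm_num)
    · rw [h]; exact Finset.card_le_three

/-! ### Lattice point counts for the elements -/

section Area

variable {k : ℕ} {s : Vertex} {q : ℕ}

theorem area_vertex (v : Vertex) (l : ℕ) (hl : 0 < l) : (Element.whole {v}).area k s l = 1 := by
  rw [Element.area, Set.ncard_eq_one]
  refine ⟨l • v, ?_⟩
  ext p
  simp only [Element.points, Finset.mem_singleton, forall_eq, Finset.sum_singleton,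
    Set.mem_ofPred_eq, Set.mem_singleton_iff]
  constructor
  · rintro ⟨w, -, rfl, rfl⟩; rfl
  · rintro rfl
    exact ⟨fun _ => l, hl, rfl, rfl⟩

/-- The map from weights to points of an edge. -/
theorem edge_injective {u v : Vertex} (h : u ≠ v) (l : ℕ) {a a' b b' : ℕ} (hab : a + b = l)
    (hab' : a' + b' = l) (he : a • u + b • v = a' • u + b' • v) : a = a' := by
  have h1 := congrArg Prod.fst he
  have h2 := congrArg Prod.snd he
  simp only [Prod.fst_add, Prod.snd_add, Prod.smul_fst, Prod.smul_snd] at h1 h2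
  simp only [nsmul_eq_mul] at h1 h2
  have hb : (b : ℤ) = l - a := by omega
  have hb' : (b' : ℤ) = l - a' := by omega
  rw [hb, hb'] at h1 h2
  have h3 : ((a : ℤ) - a') * (u.1 - v.1) = 0 := by linarith
  have h4 : ((a : ℤ) - a') * (u.2 - v.2) = 0 := by linarith
  by_contra hne
  have hne' : (a : ℤ) - a' ≠ 0 := by omega
  have h5 := (mul_eq_zero.1 h3).resolve_left hne'
  have h6 := (mul_eq_zero.1 h4).resolve_left hne'
  exact h (Prod.ext (by omega) (by omega))

theorem area_edge {u v : Vertex} (h : u ≠ v) : (Element.whole {u, v}).area k s (6 * q + 1) = 6 * q := by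
  have hp : (Element.whole {u, v}).points k s (6 * q + 1) =
      (fun a => (a + 1) • u + (6 * q - a) • v) '' (Finset.range (6 * q) : Set ℕ) := by
    ext p
    simp only [Element.points, Set.mem_ofPred_eq, Finset.sum_pair h, Finset.mem_insert,
      Finset.mem_singleton, forall_eq_or_imp, forall_eq, Set.mem_image, Finset.coe_range, Set.mem_Iio]
    constructor
    · rintro ⟨w, ⟨h1, h2⟩, h3, rfl⟩
      exact ⟨w u - 1, by omega, by rw [show w u - 1 + 1 = w u by omega,
        show 6 * q - (w u - 1) = w v by omega]⟩
    · rintro ⟨a, ha, rfl⟩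
      refine ⟨fun x => if x = u then a + 1 else 6 * q - a, ?_⟩
      simp only [if_true, if_neg h.symm, and_true]
      omega
  rw [Element.area, hp, Set.InjOn.ncard_image, Set.ncard_coe_finset, Finset.card_range]
  intro a ha a' ha' he
  simp only [Finset.coe_range, Set.mem_Iio] at ha ha'
  have := edge_injective h (6 * q + 1) (by omega) (by omega) he
  omega

theorem area_half_edge {u : Vertex} (h : u ≠ gridRotation 2 s u) :
    (Element.part {u, gridRotation 2 s u} u).area 2 s (6 * q + 1) = 3 * q := by
  -- The length `6 * q + 1` is odd, so no vertex lies on the cut; the half of `u` is given by `w u ≥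
  -- 3 * q + 1`.
  have hp : (Element.part {u, gridRotation 2 s u} u).points 2 s (6 * q + 1) =
      (fun a => (3 * q + a + 1) • u + (3 * q - a) • gridRotation 2 s u) ''
        (Finset.range (3 * q) : Set ℕ) := by
    ext p
    simp only [Element.points, Set.mem_ofPred_eq, Finset.sum_pair h, Finset.mem_insert,
      Finset.mem_singleton, forall_eq_or_imp, forall_eq, Set.mem_image, Finset.coe_range, Set.mem_Iio]
    constructor
    · rintro ⟨w, ⟨h1, h2⟩, h3, rfl, h4, h5⟩
      exact ⟨w u - 1 - 3 * q, by omega, by rw [show 3 * q + (w u - 1 - 3 * q) + 1 = w u by omega,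
        show 3 * q - (w u - 1 - 3 * q) = w (gridRotation 2 s u) by omega]⟩
    · rintro ⟨a, ha, rfl⟩
      refine ⟨fun x => if x = u then 3 * q + a + 1 else 3 * q - a, ?_⟩
      simp only [if_true, if_neg h.symm, true_and]
      omega
  rw [Element.area, hp, Set.InjOn.ncard_image, Set.ncard_coe_finset, Finset.card_range]
  intro a ha a' ha' he
  simp only [Finset.coe_range, Set.mem_Iio] at ha ha'
  have := edge_injective h (6 * q + 1) (by omega) (by omega) he
  omega

theorem dir_det : ∀ i j : Fin 6, (∃ d, dir j = dir i + dir d) →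
    (dir i).1 * (dir j).2 - (dir i).2 * (dir j).1 ≠ 0 := by
  unfold dir; decide

/-- The map from weights to points of a face. -/
theorem face_injective {u v t : Vertex} (huv : Adj u v) (htu : Adj t u) (htv : Adj t v) (l : ℕ)
    {a a' b b' c c' : ℕ} (hab : a + b + c = l) (hab' : a' + b' + c' = l)
    (he : a • u + (b • v + c • t) = a' • u + (b' • v + c' • t)) : a = a' ∧ b = b' := by
  obtain ⟨i, hi⟩ := htu
  obtain ⟨j, hj⟩ := htv
  obtain ⟨d, hd⟩ := huv
  have hdet := dir_det i j ⟨d, by rw [hj, hi, add_assoc] at hd; exact add_left_cancel hd⟩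
  have h1 := congrArg Prod.fst he
  have h2 := congrArg Prod.snd he
  rw [hi, hj] at h1 h2
  simp only [Prod.fst_add, Prod.snd_add, Prod.smul_fst, Prod.smul_snd] at h1 h2
  simp only [nsmul_eq_mul] at h1 h2
  have hb : (c : ℤ) = l - a - b := by omega
  have hb' : (c' : ℤ) = l - a' - b' := by omega
  rw [hb, hb'] at h1 h2
  have h3 : ((a : ℤ) - a') * (dir i).1 + (b - b') * (dir j).1 = 0 := by linarith
  have h4 : ((a : ℤ) - a') * (dir i).2 + (b - b') * (dir j).2 = 0 := by linarith
  have h5 : ((a : ℤ) - a') * ((dir i).1 * (dir j).2 - (dir i).2 * (dir j).1) = 0 := by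
    linear_combination (dir j).2 * h3 - (dir j).1 * h4
  have h6 : ((b : ℤ) - b') * ((dir i).1 * (dir j).2 - (dir i).2 * (dir j).1) = 0 := by
    linear_combination (dir i).1 * h4 - (dir i).2 * h3
  have h7 := (mul_eq_zero.1 h5).resolve_right hdet
  have h8 := (mul_eq_zero.1 h6).resolve_right hdet
  omega

theorem two_mul_sum_sub (c n : ℕ) (h : n ≤ c) :
    2 * ∑ b ∈ Finset.range n, (c - (b + 1)) + n * (n + 1) = 2 * c * n := by
  induction n with
  | zero => simp
  | succ n ih =>
    have := ih (by omega)
    rw [Finset.sum_range_succ]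
    obtain ⟨e, rfl⟩ := Nat.exists_eq_add_of_le h
    rw [show n + 1 + e - (n + 1) = e by omega]
    nlinarith

theorem sum_triple {M : Type} [AddCommMonoid M] {u v t : Vertex} (huv : u ≠ v) (hut : u ≠ t)
    (hvt : v ≠ t) (f : Vertex → M) : ∑ x ∈ ({u, v, t} : Finset Vertex), f x = f u + (f v + f t) := by
  rw [Finset.sum_insert (by simp [huv, hut]), Finset.sum_pair hvt]

theorem area_face {u v t : Vertex} (huv : u ≠ v) (hut : u ≠ t) (hvt : v ≠ t) (auv : Adj u v)
    (atu : Adj t u) (atv : Adj t v) :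
    (Element.whole {u, v, t}).area k s (6 * q + 1) = 3 * q * (6 * q - 1) := by
  have hp : (Element.whole {u, v, t}).points k s (6 * q + 1) =
      (fun x : (_ : ℕ) × ℕ => (x.1 + 1) • u + ((x.2 + 1) • v + (6 * q - 1 - x.1 - x.2) • t)) ''
        ((Finset.range (6 * q)).sigma fun b => Finset.range (6 * q - (b + 1)) :
          Finset ((_ : ℕ) × ℕ)) := by
    ext p
    simp only [Element.points, Set.mem_ofPred_eq, sum_triple huv hut hvt, Finset.mem_insert,
      Finset.mem_singleton, forall_eq_or_imp, forall_eq, Set.mem_image, Finset.mem_coe,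
      Finset.mem_sigma, Finset.mem_range]
    constructor
    · rintro ⟨w, ⟨h1, h2, h3⟩, h4, rfl⟩
      refine ⟨⟨w u - 1, w v - 1⟩, by simp only; omega, ?_⟩
      simp only
      rw [show w u - 1 + 1 = w u by omega, show w v - 1 + 1 = w v by omega,
        show 6 * q - 1 - (w u - 1) - (w v - 1) = w t by omega]
    · rintro ⟨⟨a, b⟩, hab, rfl⟩
      simp only at hab
      refine ⟨fun x => if x = u then a + 1 else if x = v then b + 1 else 6 * q - 1 - a - b, ?_⟩
      simp only [if_true, if_neg huv.symm, if_neg hut.symm, if_neg hvt.symm, and_true]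
      omega
  rw [Element.area, hp, Set.InjOn.ncard_image, Set.ncard_coe_finset, Finset.card_sigma]
  · simp only [Finset.card_range]
    have h := two_mul_sum_sub (6 * q) (6 * q) le_rfl
    rcases q with _ | q
    · simp
    · have : 6 * (q + 1) - 1 = 6 * q + 5 := by omega
      rw [this]
      nlinarith
  · rintro ⟨a, b⟩ ha ⟨a', b'⟩ ha' he
    simp only [Finset.mem_coe, Finset.mem_sigma, Finset.mem_range] at ha ha' he
    have := face_injective auv atu atv (6 * q + 1) (by omega) (by omega) he
    obtain ⟨rfl, rfl⟩ : a = a' ∧ b = b' := by omega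
    rfl

theorem area_third_face {u t : Vertex} (huv : u ≠ gridRotation 3 s u) (hut : u ≠ t)
    (hvt : gridRotation 3 s u ≠ t) (auv : Adj u (gridRotation 3 s u))
    (atu : Adj t u) (atv : Adj t (gridRotation 3 s u)) :
    (Element.part {u, gridRotation 3 s u, t} u).area 3 s (6 * q + 1) = q * (6 * q - 1) := by
  -- Since `6 * q + 1` is not divisible by 3, the cuts avoid the grid and the inequalities become `w
  -- u ≥ 2 * q + 1` and `w (ρ u) ≤ 2 * q`. For `w (ρ u) = b + 1` this leaves `4 * q - (b + 1)`
  -- choices of `w u`.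
  have hp : (Element.part {u, gridRotation 3 s u, t} u).points 3 s (6 * q + 1) =
      (fun x : (_ : ℕ) × ℕ => (2 * q + 1 + x.2) • u +
        ((x.1 + 1) • gridRotation 3 s u + (4 * q - 1 - x.1 - x.2) • t)) ''
        ((Finset.range (2 * q)).sigma fun b => Finset.range (4 * q - (b + 1)) :
          Finset ((_ : ℕ) × ℕ)) := by
    ext p
    simp only [Element.points, Set.mem_ofPred_eq, sum_triple huv hut hvt, Finset.mem_insert,
      Finset.mem_singleton, forall_eq_or_imp, forall_eq, Set.mem_image, Finset.mem_coe,
      Finset.mem_sigma, Finset.mem_range]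
    constructor
    · rintro ⟨w, ⟨h1, h2, h3⟩, h4, rfl, h5, h6⟩
      refine ⟨⟨w (gridRotation 3 s u) - 1, w u - (2 * q + 1)⟩, by simp only; omega, ?_⟩
      simp only
      rw [show 2 * q + 1 + (w u - (2 * q + 1)) = w u by omega,
        show w (gridRotation 3 s u) - 1 + 1 = w (gridRotation 3 s u) by omega,
        show 4 * q - 1 - (w (gridRotation 3 s u) - 1) - (w u - (2 * q + 1)) = w t by omega]
    · rintro ⟨⟨b, a⟩, hab, rfl⟩
      simp only at hab
      refine ⟨fun x => if x = u then 2 * q + 1 + a else if x = gridRotation 3 s u then b + 1 else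
        4 * q - 1 - b - a, ?_⟩
      simp only [if_true, if_neg huv.symm, if_neg hut.symm, if_neg hvt.symm, true_and]
      omega
  rw [Element.area, hp, Set.InjOn.ncard_image, Set.ncard_coe_finset, Finset.card_sigma]
  · simp only [Finset.card_range]
    have h := two_mul_sum_sub (4 * q) (2 * q) (by omega)
    rcases q with _ | q
    · simp
    · have : 6 * (q + 1) - 1 = 6 * q + 5 := by omega
      rw [this]
      nlinarith
  · rintro ⟨b, a⟩ ha ⟨b', a'⟩ ha' he
    simp only [Finset.mem_coe, Finset.mem_sigma, Finset.mem_range] at ha ha' he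
    have := face_injective auv atu atv (6 * q + 1) (by omega) (by omega) he
    obtain ⟨rfl, rfl⟩ : a = a' ∧ b = b' := by omega
    rfl

/-- The area at scale `6 * q + 1` of the elements of rank `n`. -/
def rankArea (q : ℕ) : ℕ → ℕ
  | 2 => 1
  | 3 => 3 * q
  | 4 => 6 * q
  | 5 => q * (6 * q - 1)
  | 6 => 3 * q * (6 * q - 1)
  | _ => 0

/-- A half-turn without fixed vertices has orbits of size 2. A second orbit in the cell would give
it four vertices, but a cell has at most three. -/
theorem central_edge {σ : Finset Vertex} (hσ : ∀ u ∈ σ, ∀ v ∈ σ, u ≠ v → Adj u v)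
    (hfix : ∀ v, gridRotation 2 s v ≠ v) (himg : σ.image (gridRotation 2 s) = σ) {v : Vertex}
    (hv : v ∈ σ) : σ = {v, gridRotation 2 s v} := by
  have hmem : ∀ u ∈ σ, gridRotation 2 s u ∈ σ := fun u hu =>
    himg ▸ Finset.mem_image_of_mem _ hu
  have hinv : ∀ u, gridRotation 2 s (gridRotation 2 s u) = u := fun u => by simp [gridRotation_two]
  ext t
  simp only [Finset.mem_insert, Finset.mem_singleton]
  constructor
  · intro ht
    by_contra! hne
    obtain ⟨h1, h2⟩ := hne
    have hsub : ({v, gridRotation 2 s v, t, gridRotation 2 s t} : Finset Vertex) ⊆ σ := by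
      intro x
      simp only [Finset.mem_insert, Finset.mem_singleton]
      rintro (rfl | rfl | rfl | rfl)
      exacts [hv, hmem _ hv, ht, hmem _ ht]
    have hcard : ({v, gridRotation 2 s v, t, gridRotation 2 s t} : Finset Vertex).card = 4 := by
      have h3 : v ≠ gridRotation 2 s t := fun h => h2 (by rw [h, hinv])
      have h4 : gridRotation 2 s v ≠ gridRotation 2 s t := fun h =>
        h1 (gridRotation_injective 2 s h).symm
      rw [Finset.card_insert_of_notMem (by simp [(hfix v).symm, h1.symm, h3]),
        Finset.card_insert_of_notMem (by simp [h2.symm, h4]), Finset.card_pair (hfix t).symm]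
    have := (Finset.card_le_card hsub).trans (cell_card_le hσ)
    omega
  · rintro (rfl | rfl)
    exacts [hv, hmem _ hv]

theorem gridRotation_three_ne (hfix : ∀ v, gridRotation 3 s v ≠ v) (v : Vertex) :
    v ≠ gridRotation 3 s (gridRotation 3 s v) := by
  intro h
  apply hfix v
  have h3 := congrFun (gridRotation_iterate (k := 3) (s := s) (by simp)) v
  simp only [Function.iterate_succ, Function.iterate_zero, Function.comp_apply, id] at h3
  rw [← h] at h3
  exact h3

theorem central_face {σ : Finset Vertex} (hσ : ∀ u ∈ σ, ∀ v ∈ σ, u ≠ v → Adj u v)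
    (hfix : ∀ v, gridRotation 3 s v ≠ v) (himg : σ.image (gridRotation 3 s) = σ) {v : Vertex}
    (hv : v ∈ σ) : σ = {v, gridRotation 3 s v, gridRotation 3 s (gridRotation 3 s v)} := by
  have hmem : ∀ u ∈ σ, gridRotation 3 s u ∈ σ := fun u hu =>
    himg ▸ Finset.mem_image_of_mem _ hu
  symm
  apply Finset.eq_of_subset_of_card_le
  · intro x
    simp only [Finset.mem_insert, Finset.mem_singleton]
    rintro (rfl | rfl | rfl)
    exacts [hv, hmem _ hv, hmem _ (hmem _ hv)]
  · rw [Finset.card_insert_of_notMem (by simp [(hfix v).symm, gridRotation_three_ne hfix v]),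
      Finset.card_pair (hfix _).symm]
    exact cell_card_le hσ

/-- The areas of the elements of a shape. -/
theorem area_eq_rankArea {S : Shape} (h : S.Compatible k s) {x : Element} (hx : x ∈ S.elements k s)
    (q : ℕ) : 2 ≤ x.rank ∧ x.rank ≤ 6 ∧ x.area k s (6 * q + 1) = rankArea q x.rank := by
  rcases hx with ⟨σ, hσ, -, rfl⟩ | ⟨σ, hσ, ⟨hk, himg⟩, v, hv, rfl⟩
  · have hadj := S.cell_adj σ hσ
    obtain ⟨v, hv⟩ := S.cell_nonempty σ hσ
    rcases cell_cases hadj hv with h | ⟨d, h | h⟩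
    · subst h
      refine ⟨by simp [Element.rank], by simp [Element.rank], ?_⟩
      rw [area_vertex v _ (by omega)]
      simp [Element.rank, rankArea]
    · subst h
      have hne : v ≠ v + dir d := fun h => dir_ne_zero d (by simpa using h)
      refine ⟨by simp [Element.rank, Finset.card_pair hne],
        by simp [Element.rank, Finset.card_pair hne], ?_⟩
      rw [area_edge hne]
      simp [Element.rank, Finset.card_pair hne, rankArea]
    · have h1 : v ≠ v + dir d := fun h => dir_ne_zero d (by simpa using h)
      have h2 : v ≠ v + dir (d + 1) := fun h => dir_ne_zero (d + 1) (by simpa using h)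
      have h3 : v + dir d ≠ v + dir (d + 1) := fun h =>
        (by decide : ∀ d : Fin 6, d ≠ d + 1) d (dir_injective (add_left_cancel h))
      subst h
      have hcard : ({v, v + dir d, v + dir (d + 1)} : Finset Vertex).card = 3 :=
        Finset.card_eq_three.2 ⟨_, _, _, h1, h2, h3, rfl⟩
      refine ⟨by simp [Element.rank, hcard], by simp [Element.rank, hcard], ?_⟩
      rw [area_face h1 h2 h3 (hadj _ (by simp) _ (by simp) h1) (hadj _ (by simp) _ (by simp) h2.symm)
        (hadj _ (by simp) _ (by simp) h3.symm)]
      simp [Element.rank, hcard, rankArea]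
  · have hadj := S.cell_adj σ hσ
    rcases h with ⟨rfl, rfl⟩ | ⟨rfl | rfl, -, hfix⟩
    · exact absurd rfl hk
    · have h := central_edge hadj hfix himg hv
      rw [h]
      have hcard := Finset.card_pair (hfix v).symm
      refine ⟨by simp [Element.rank, hcard], by simp [Element.rank, hcard], ?_⟩
      rw [area_half_edge (hfix v).symm]
      simp [Element.rank, hcard, rankArea]
    · have h := central_face hadj hfix himg hv
      have h1 := (hfix v).symm
      have h2 := gridRotation_three_ne hfix v
      have h3 := (hfix (gridRotation 3 s v)).symm
      have hcard : ({v, gridRotation 3 s v, gridRotation 3 s (gridRotation 3 s v)} :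
          Finset Vertex).card = 3 := Finset.card_eq_three.2 ⟨_, _, _, h1, h2, h3, rfl⟩
      rw [h] at hadj ⊢
      refine ⟨by simp [Element.rank, hcard], by simp [Element.rank, hcard], ?_⟩
      rw [area_third_face h1 h2 h3 (hadj _ (by simp) _ (by simp) h1)
        (hadj _ (by simp) _ (by simp) h2.symm) (hadj _ (by simp) _ (by simp) h3.symm)]
      simp [Element.rank, hcard, rankArea]

end Area

/-! ## Selections of elements -/

/-- A finite set with a free action of a cyclic group of order `k` has a transversal. -/
theorem exists_transversal {α : Type} [DecidableEq α] (E : Finset α) (f : α → α) {k : ℕ} (hk : 0 < k)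
    (hE : ∀ x ∈ E, f x ∈ E) (hf : f^[k] = id)
    (hfree : ∀ x ∈ E, ∀ j, 0 < j → j < k → f^[j] x ≠ x) :
    ∃ R ⊆ E, ∀ x ∈ E, ∃! j : Fin k, ∃ y ∈ R, f^[(j : ℕ)] y = x := by
  have hmul : ∀ n, f^[k * n] = id := fun n => by
    rw [Function.iterate_mul, hf, Function.iterate_id]
  have hmod : ∀ n, f^[n % k] = f^[n] := fun n => by
    conv_rhs => rw [← Nat.mod_add_div n k, Function.iterate_add, hmul, Function.comp_id]
  have hinj : Function.Injective f := by
    intro x y h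
    have : f^[k] x = f^[k] y := by
      obtain ⟨n, rfl⟩ := Nat.exists_eq_succ_of_ne_zero hk.ne'
      rw [Function.iterate_succ_apply, Function.iterate_succ_apply, h]
    simpa [hf] using this
  -- The orbit relation; the inverse of `f^[j]` is `f^[k * j - j]`. One representative of each orbit
  -- is taken.
  let r : Setoid α :=
    { r := fun x y => ∃ j, f^[j] x = y
      iseqv := by
        refine ⟨fun x => ⟨0, rfl⟩, ?_, ?_⟩
        · rintro x y ⟨j, rfl⟩
          refine ⟨k * j - j, ?_⟩
          rw [← Function.iterate_add_apply, Nat.sub_add_cancel (Nat.le_mul_of_pos_left j hk), hmul]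
          rfl
        · rintro x y z ⟨i, rfl⟩ ⟨j, rfl⟩
          exact ⟨j + i, Function.iterate_add_apply _ _ _ _⟩ }
  let rep : α → α := fun x => (Quotient.mk r x).out
  have hrep : ∀ x, r (rep x) x := fun x => Quotient.mk_out (s := r) x
  have hrep_eq : ∀ x y, r x y → rep x = rep y := fun x y h =>
    congrArg Quotient.out (Quotient.sound (s := r) h)
  have hiter : ∀ x ∈ E, ∀ j, f^[j] x ∈ E := by
    intro x hx j
    induction j with
    | zero => exact hx
    | succ j ih => rw [Function.iterate_succ_apply']; exact hE _ ih
  refine ⟨E.image rep, ?_, ?_⟩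
  · intro y hy
    obtain ⟨x, hx, rfl⟩ := Finset.mem_image.1 hy
    obtain ⟨j, hj⟩ := r.symm (hrep x)
    rw [← hj]
    exact hiter x hx j
  · intro x hx
    obtain ⟨j, hj⟩ := hrep x
    have huniq : ∀ i j : ℕ, i < j → j < k → ∀ y ∈ E, f^[i] y ≠ f^[j] y := by
      intro i j hij hjk y hy h
      apply hfree y hy (j - i) (by omega) (by omega)
      apply hinj.iterate i
      rw [← Function.iterate_add_apply, Nat.add_sub_cancel' hij.le, h]
    refine ⟨⟨j % k, Nat.mod_lt _ hk⟩, ⟨rep x, Finset.mem_image_of_mem _ hx, ?_⟩, ?_⟩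
    · simp only [hmod, hj]
    · rintro i ⟨y, hy, hyx⟩
      obtain ⟨z, hz, rfl⟩ := Finset.mem_image.1 hy
      have h1 : rep z = rep x := hrep_eq z x (r.trans (r.symm (hrep z)) ⟨_, hyx⟩)
      have h2 : rep x ∈ E := by
        obtain ⟨j, hj⟩ := r.symm (hrep x)
        rw [← hj]
        exact hiter x hx j
      rw [h1] at hyx
      have h3 : f^[j % k] (rep x) = x := by rw [hmod, hj]
      apply Fin.ext
      simp only
      rcases lt_trichotomy (i : ℕ) (j % k) with h | h | h
      · exact absurd (hyx.trans h3.symm) (huniq _ _ h (Nat.mod_lt _ hk) _ h2)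
      · exact h
      · exact absurd (h3.trans hyx.symm) (huniq _ _ h i.2 _ h2)

namespace Element

theorem rotate_iterate (ρ : Vertex → Vertex) (n : ℕ) : (rotate ρ)^[n] = rotate ρ^[n] := by
  induction n with
  | zero => funext x; cases x <;> simp [rotate]
  | succ n ih =>
    rw [Function.iterate_succ, ih]
    funext x
    cases x <;> simp [rotate, Finset.image_image]

theorem rotate_id : rotate id = id := by
  funext x; cases x <;> simp [rotate]

theorem rotate_cell (ρ : Vertex → Vertex) (x : Element) : (x.rotate ρ).cell = x.cell.image ρ := by
  cases x <;> rfl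

end Element

namespace Shape

variable (S : Shape)

theorem Compatible.kind {S : Shape} {k : ℕ} {s : Vertex} (h : S.Compatible k s) :
    (k = 1 ∧ s = 0) ∨ k = 2 ∨ k = 3 := by
  rcases h with h | ⟨h, -⟩
  · exact Or.inl h
  · exact Or.inr h

theorem Compatible.image_mem {S : Shape} {k : ℕ} {s : Vertex} (h : S.Compatible k s)
    {σ : Finset Vertex} (hσ : σ ∈ S.cells) : σ.image (gridRotation k s) ∈ S.cells := by
  rcases h with ⟨rfl, rfl⟩ | ⟨-, h, -⟩
  · have : gridRotation 1 0 = id := funext gridRotation_one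
    rwa [this, Finset.image_id]
  · exact h σ hσ

theorem Compatible.rotate_mem {S : Shape} {k : ℕ} {s : Vertex} (h : S.Compatible k s) {x : Element}
    (hx : x ∈ S.elements k s) : x.rotate (gridRotation k s) ∈ S.elements k s := by
  rcases hx with ⟨σ, hσ, h', rfl⟩ | ⟨σ, hσ, ⟨hk, himg⟩, v, hv, rfl⟩
  · refine Or.inl ⟨_, h.image_mem hσ, ?_, rfl⟩
    refine h'.imp id fun h1 h2 => h1 ?_
    exact Finset.image_injective (gridRotation_injective k s) h2
  · exact Or.inr ⟨_, h.image_mem hσ, ⟨hk, by rw [himg, himg]⟩, _, Finset.mem_image_of_mem _ hv, rfl⟩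

/-- All conceivable elements, for all `k`. -/
def allElements : Finset Element :=
  S.cells.image Element.whole ∪ S.cells.biUnion fun σ => σ.image (Element.part σ)

theorem elements_subset {k : ℕ} {s : Vertex} {x : Element} (hx : x ∈ S.elements k s) :
    x ∈ S.allElements := by
  simp only [allElements, Finset.mem_union, Finset.mem_image, Finset.mem_biUnion]
  rcases hx with ⟨σ, hσ, -, rfl⟩ | ⟨σ, hσ, -, v, hv, rfl⟩
  · exact Or.inl ⟨σ, hσ, rfl⟩
  · exact Or.inr ⟨σ, hσ, v, hv, rfl⟩

/-- The rotation acts freely on the elements: invariant cells have been cut for `k > 1`, and parts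
are distinguished by their corners, which are not fixed. As `k ≤ 3`, a fixed point of the square for
`k = 3` would be one of the rotation itself. -/
theorem exists_selection {k : ℕ} {s : Vertex} (h : S.Compatible k s) :
    ∃ R, S.IsSelection k s R := by
  classical
  let E := S.allElements.filter fun x => x ∈ S.elements k s
  have hE : ∀ x, x ∈ E ↔ x ∈ S.elements k s := fun x => by
    simp only [E, Finset.mem_filter, and_iff_right_iff_imp]
    exact S.elements_subset
  have hk : 0 < k := by rcases h.kind with h | h | h <;> omega
  have hid : (Element.rotate (gridRotation k s))^[k] = id := by
    rw [Element.rotate_iterate, gridRotation_iterate h.kind, Element.rotate_id]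
  obtain ⟨R, hR, hR'⟩ := exists_transversal E (Element.rotate (gridRotation k s)) hk
    (fun x hx => (hE _).2 (h.rotate_mem ((hE x).1 hx))) hid (by
      intro x hx j hj hjk
      have hx := (hE x).1 hx
      have hone : Element.rotate (gridRotation k s) x ≠ x := by
        rcases h with ⟨rfl, -⟩ | ⟨h23, -, hfix⟩
        · omega
        · rcases hx with ⟨σ, hσ, h', rfl⟩ | ⟨σ, hσ, -, v, hv, rfl⟩
          · simp only [Element.rotate, ne_eq, Element.whole.injEq]
            exact h'.resolve_left (by omega)
          · simp only [Element.rotate, ne_eq, Element.part.injEq, not_and]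
            exact fun _ => hfix v
      intro hjx
      rcases h.kind with ⟨rfl, -⟩ | rfl | rfl
      · omega
      · obtain rfl : j = 1 := by omega
        exact hone hjx
      · obtain rfl | rfl : j = 1 ∨ j = 2 := by omega
        · exact hone hjx
        · apply hone
          have h3 := congrFun hid x
          rw [Function.iterate_succ_apply', hjx] at h3
          exact h3)
  exact ⟨R, fun x hx => (hE x).1 (hR hx), fun x hx => hR' x ((hE x).2 hx)⟩

/-- The vertices of a shape. -/
def vertices : Finset Vertex := S.cells.biUnion id

theorem mem_vertices {v : Vertex} : v ∈ S.vertices ↔ {v} ∈ S.cells := by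
  simp only [vertices, Finset.mem_biUnion, id]
  constructor
  · rintro ⟨σ, hσ, hv⟩
    exact S.closed σ hσ {v} (by simpa using hv) (by simp)
  · intro h
    exact ⟨_, h, by simp⟩

theorem card_vertices_le : S.vertices.card ≤ S.size := by
  apply Finset.card_le_card_of_injOn (fun v => {v})
  · intro v hv
    simp only [Finset.coe_filter, Set.mem_ofPred_eq, Finset.card_singleton, and_true]
    exact S.mem_vertices.1 hv
  · intro u _ v _ h
    simpa using h

theorem vertices_nonempty : S.vertices.Nonempty := by
  obtain ⟨σ, hσ⟩ := S.nonempty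
  obtain ⟨v, hv⟩ := S.cell_nonempty σ hσ
  exact ⟨v, Finset.mem_biUnion.2 ⟨σ, hσ, hv⟩⟩

/-- Each cell is one of the `1 + 6 + 6` cells at one of its vertices. -/
theorem card_cells_le : S.cells.card ≤ 13 * S.size := by
  have hsub : S.cells ⊆ S.vertices.biUnion fun v => {{v}} ∪
      ((Finset.univ.image fun d => {v, v + dir d}) ∪
        Finset.univ.image fun d => {v, v + dir d, v + dir (d + 1)}) := by
    intro σ hσ
    obtain ⟨v, hv⟩ := S.cell_nonempty σ hσ
    simp only [Finset.mem_biUnion, Finset.mem_union, Finset.mem_singleton, Finset.mem_image,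
      Finset.mem_univ, true_and]
    refine ⟨v, Finset.mem_biUnion.2 ⟨σ, hσ, hv⟩, ?_⟩
    rcases cell_cases (S.cell_adj σ hσ) hv with h | ⟨d, h | h⟩
    · exact Or.inl h
    · exact Or.inr (Or.inl ⟨d, h.symm⟩)
    · exact Or.inr (Or.inr ⟨d, h.symm⟩)
  refine (Finset.card_le_card hsub).trans ((Finset.card_biUnion_le_card_mul _ _ 13 ?_).trans ?_)
  · intro v _
    refine (Finset.card_union_le _ _).trans ?_
    have h1 := Finset.card_union_le
      ((Finset.univ : Finset (Fin 6)).image fun d => ({v, v + dir d} : Finset Vertex))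
      ((Finset.univ : Finset (Fin 6)).image fun d => {v, v + dir d, v + dir (d + 1)})
    have h2 := Finset.card_image_le (s := (Finset.univ : Finset (Fin 6)))
      (f := fun d => ({v, v + dir d} : Finset Vertex))
    have h3 := Finset.card_image_le (s := (Finset.univ : Finset (Fin 6)))
      (f := fun d => ({v, v + dir d, v + dir (d + 1)} : Finset Vertex))
    simp only [Finset.card_univ, Fintype.card_fin, Finset.card_singleton] at h2 h3 ⊢
    omega
  · have := S.card_vertices_le
    omega

theorem card_allElements_le : S.allElements.card ≤ 52 * S.size := by
  have h1 := S.card_cells_le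
  have h2 : (S.cells.biUnion fun σ => σ.image (Element.part σ)).card ≤ S.cells.card * 3 :=
    Finset.card_biUnion_le_card_mul _ _ _ fun σ hσ =>
      Finset.card_image_le.trans (cell_card_le (S.cell_adj σ hσ))
  have h3 : (S.cells.image Element.whole).card ≤ S.cells.card := Finset.card_image_le
  have h4 := Finset.card_union_le (S.cells.image Element.whole)
    (S.cells.biUnion fun σ => σ.image (Element.part σ))
  unfold allElements
  omega

/-- The center of symmetry is the barycenter of the vertices. -/
theorem Compatible.unique {S : Shape} {k : ℕ} {s s' : Vertex} (h : S.Compatible k s)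
    (h' : S.Compatible k s') : s = s' := by
  -- The rotation permutes the vertices. Comparing the sums of the vertices and of their images
  -- determines the multiple of `s` by the number of vertices.
  have key : ∀ s, S.Compatible k s →
      ∑ v ∈ S.vertices, rot60^[6 / k] v + S.vertices.card • s = ∑ v ∈ S.vertices, v := by
    intro s h
    have himg : S.vertices.image (gridRotation k s) = S.vertices := by
      apply Finset.eq_of_subset_of_card_le
      · intro u hu
        obtain ⟨v, hv, rfl⟩ := Finset.mem_image.1 hu
        rw [S.mem_vertices] at hv ⊢
        simpa using h.image_mem hv
      · rw [Finset.card_image_of_injective _ (gridRotation_injective k s)]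
    conv_rhs => rw [← himg, Finset.sum_image (gridRotation_injective k s).injOn]
    simp only [gridRotation, Finset.sum_add_distrib, Finset.sum_const]
  have heq := add_left_cancel ((key s h).trans (key s' h').symm)
  have hpos : (S.vertices.card : ℤ) ≠ 0 := by
    have := S.vertices_nonempty.card_pos
    omega
  have h1 := congrArg Prod.fst heq
  have h2 := congrArg Prod.snd heq
  simp only [Prod.smul_fst, Prod.smul_snd] at h1 h2
  simp only [nsmul_eq_mul] at h1 h2
  exact Prod.ext (mul_left_cancel₀ hpos h1) (mul_left_cancel₀ hpos h2)

/-- Rotations preserve the dimension of cells, so every dimension that occurs in the shape occurs in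
`R`. This controls the kind of the last element of the sorted list. -/
theorem IsSelection.exists_card_eq {S : Shape} {k : ℕ} {s : Vertex} {R : Finset Element}
    (hR : S.IsSelection k s R) {σ : Finset Vertex} (hσ : σ ∈ S.cells) :
    ∃ x ∈ R, x.cell.card = σ.card := by
  have hx : ∃ x ∈ S.elements k s, x.cell = σ := by
    by_cases hc : k = 1 ∨ σ.image (gridRotation k s) ≠ σ
    · exact ⟨.whole σ, Or.inl ⟨σ, hσ, hc, rfl⟩, rfl⟩
    · obtain ⟨v, hv⟩ := S.cell_nonempty σ hσ
      rw [not_or, not_not] at hc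
      exact ⟨.part σ v, Or.inr ⟨σ, hσ, hc, v, hv, rfl⟩, rfl⟩
  obtain ⟨x, hx, rfl⟩ := hx
  obtain ⟨j, ⟨y, hy, rfl⟩, -⟩ := hR.2 x hx
  refine ⟨y, hy, ?_⟩
  rw [Element.rotate_iterate, Element.rotate_cell,
    Finset.card_image_of_injective _ ((gridRotation_injective k s).iterate _)]

theorem elements_cell_mem {k : ℕ} {s : Vertex} {x : Element} (hx : x ∈ S.elements k s) :
    x.cell ∈ S.cells := by
  rcases hx with ⟨σ, hσ, -, rfl⟩ | ⟨σ, hσ, -, v, hv, rfl⟩ <;> exact hσ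

theorem exists_edge : ∃ σ ∈ S.cells, σ.card = 2 := by
  obtain ⟨u, hu⟩ := S.vertices_nonempty
  obtain ⟨v, hv, h⟩ := S.covered u (S.mem_vertices.1 hu)
  exact ⟨_, h, Finset.card_pair hv.symm⟩

end Shape

/-! ## The counters for the boundaries between Roles -/

/-- The growth of the area of an element of rank `n` in a sweep. -/
def rankInc : Phase → ℕ → ℕ
  | .first, n => rankArea 1 n
  | .inner, 5 => 12
  | .inner, 6 => 36
  | .inner, _ => 0
  | .outer, 3 => 3
  | .outer, 4 => 6
  | .outer, 5 => 5
  | .outer, 6 => 15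
  | .outer, _ => 0

theorem rankInc_le {n : ℕ} (h : 2 ≤ n) (h' : n ≤ 6) (ph : Phase) : rankInc ph n ≤ 36 := by
  interval_cases n <;> cases ph <;> simp [rankInc, rankArea]

/-- The recursion that the machine executes: `q` inner sweeps and one outer sweep. The quadratic
areas `6q² - q` and `18q² - 3q` have differences `12q + 5` and `36q + 15`. -/
theorem rankArea_succ {n : ℕ} (h : 2 ≤ n) (h' : n ≤ 6) (q : ℕ) :
    rankArea (q + 1) n = rankArea q n + q * rankInc .inner n + rankInc .outer n := by
  have h1 : 6 * (q + 1) - 1 = 6 * q + 5 := by omega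
  rcases q with _ | q
  · interval_cases n <;> rfl
  · have h2 : 6 * (q + 1) - 1 = 6 * q + 5 := by omega
    interval_cases n <;> simp only [rankInc, rankArea, h1, h2] <;> ring

theorem rankInc_inner_eq_zero {n : ℕ} (h : n < 5) : rankInc .inner n = 0 := by
  interval_cases n <;> rfl

theorem rankArea_succ_le {n : ℕ} (h : 2 ≤ n) (h' : n ≤ 6) (q : ℕ) :
    rankArea (q + 1) n ≤ rankArea q n + 36 * (q + 1) := by
  rw [rankArea_succ h h']
  have h1 := rankInc_le h h' .inner
  have h2 := rankInc_le h h' .outer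
  nlinarith

theorem rankArea_succ_le_of_lt {n : ℕ} (h : 2 ≤ n) (h' : n < 5) (q : ℕ) :
    rankArea (q + 1) n ≤ rankArea q n + 6 := by
  rw [rankArea_succ h (by omega), rankInc_inner_eq_zero h']
  interval_cases n <;> simp [rankInc]

theorem rankArea_le {n : ℕ} (h : 2 ≤ n) (h' : n ≤ 6) (q : ℕ) :
    rankArea (q + 1) n ≤ 18 * (q + 1) ^ 2 := by
  have h1 : 6 * (q + 1) - 1 = 6 * q + 5 := by omega
  interval_cases n <;> simp only [rankArea, h1] <;> nlinarith

theorem le_rankArea_of_five_le {n : ℕ} (h : 5 ≤ n) (h' : n ≤ 6) (q : ℕ) :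
    5 * (q + 1) ^ 2 ≤ rankArea (q + 1) n := by
  have h1 : 6 * (q + 1) - 1 = 6 * q + 5 := by omega
  interval_cases n <;> simp only [rankArea, h1] <;> nlinarith

theorem le_rankArea {n : ℕ} (h : 3 ≤ n) (h' : n ≤ 6) (q : ℕ) :
    3 * (q + 1) ≤ rankArea (q + 1) n := by
  have h1 : 6 * (q + 1) - 1 = 6 * q + 5 := by omega
  interval_cases n <;> simp only [rankArea, h1] <;> nlinarith

section Excess

variable {R : Finset Element}

/-- If there are enough particles, then the scale is large. -/
theorem scale_large (hR : ∀ x ∈ R, 2 ≤ x.rank ∧ x.rank ≤ 6)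
    {m k N q : ℕ} (hm : 0 < m) (hcard : R.card ≤ 52 * m) (hk : k ≤ 3)
    (hN : 2808 * 780 ^ 2 * m ^ 3 ≤ k * N) (hq : N ≤ ∑ x ∈ R, rankArea (q + 1) x.rank) :
    780 * m ≤ q + 1 := by
  have h1 : ∑ x ∈ R, rankArea (q + 1) x.rank ≤ R.card * (18 * (q + 1) ^ 2) :=
    Finset.sum_le_card_nsmul _ _ _ fun x hx => rankArea_le (hR x hx).1 (hR x hx).2 q
  have h2 : R.card * (18 * (q + 1) ^ 2) ≤ 52 * m * (18 * (q + 1) ^ 2) :=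
    Nat.mul_le_mul_right _ hcard
  have h3 : k * N ≤ 3 * N := Nat.mul_le_mul_right _ hk
  -- `2808 = 3 * 52 * 18` collects the bounds on `k`, on the elements per vertex and on the areas;
  -- `780 = 15 * 52` is what `two_mul_excess_le` needs.
  have h4 : m * (2808 * (780 * m) ^ 2) ≤ m * (2808 * (q + 1) ^ 2) := by nlinarith
  have h5 := Nat.le_of_mul_le_mul_left h4 hm
  have h6 : (780 * m) ^ 2 ≤ (q + 1) ^ 2 := by omega
  exact (Nat.pow_le_pow_iff_left (by norm_num)).1 h6

/-- The missing particles amount to at most half of the last element. -/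
theorem two_mul_excess_le (hR : ∀ x ∈ R, 2 ≤ x.rank ∧ x.rank ≤ 6)
    {N q : ℕ} (hcard : 15 * R.card ≤ q + 2)
    (hlt : ∑ x ∈ R, rankArea (q + 1) x.rank < N) {y : Element} (hy : y ∈ R)
    (hmax : ∀ x ∈ R, x.rank ≤ y.rank) (hy3 : 3 ≤ y.rank) :
    2 * (∑ x ∈ R, rankArea (q + 2) x.rank - N) ≤ rankArea (q + 2) y.rank := by
  by_cases h5 : 5 ≤ y.rank
  · have h1 : ∑ x ∈ R, rankArea (q + 2) x.rank ≤
        ∑ x ∈ R, (rankArea (q + 1) x.rank + 36 * (q + 2)) :=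
      Finset.sum_le_sum fun x hx => rankArea_succ_le (hR x hx).1 (hR x hx).2 _
    rw [Finset.sum_add_distrib, Finset.sum_const, smul_eq_mul] at h1
    have h2 := le_rankArea_of_five_le h5 (hR y hy).2 (q + 1)
    -- This is where `15 * R.card ≤ q + 2` is used: `72 / 15 ≤ 5`. In the other case, linear growth
    -- of at most `6` per element suffices against `3 * (q + 2)`.
    have h3 : 2 * (R.card * (36 * (q + 2))) ≤ 5 * (q + 2) ^ 2 := by nlinarith
    have h4 : q + 1 + 1 = q + 2 := rfl
    rw [h4] at h2
    omega
  · have h1 : ∑ x ∈ R, rankArea (q + 2) x.rank ≤ ∑ x ∈ R, (rankArea (q + 1) x.rank + 6) :=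
      Finset.sum_le_sum fun x hx => rankArea_succ_le_of_lt (hR x hx).1
        (lt_of_le_of_lt (hmax x hx) (by omega)) _
    rw [Finset.sum_add_distrib, Finset.sum_const, smul_eq_mul] at h1
    have h2 := le_rankArea hy3 (hR y hy).2 (q + 1)
    have h4 : q + 1 + 1 = q + 2 := rfl
    rw [h4] at h2
    omega

end Excess

section Tracks

/-- The sum of the values of `f` over the first `n` elements of a list. -/
def partialSum (el : List Element) (f : Element → ℕ) (n : ℕ) : ℕ := ((el.take n).map f).sum

theorem partialSum_succ {el : List Element} {n : ℕ} (h : n < el.length) (f : Element → ℕ) :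
    partialSum el f (n + 1) = partialSum el f n + f el[n] := by
  rw [partialSum, List.take_add_one, List.getElem?_eq_getElem h]
  simp only [Option.toList, List.map_append, List.sum_append, List.map_cons, List.map_nil,
    List.sum_cons, List.sum_nil, partialSum, add_zero]

theorem partialSum_of_length_le {el : List Element} {n : ℕ} (h : el.length ≤ n)
    (f : Element → ℕ) : partialSum el f n = (el.map f).sum := by
  rw [partialSum, List.take_of_length_le h]

theorem partialSum_le (el : List Element) (f : Element → ℕ) (b n : ℕ) (h : ∀ x ∈ el, f x ≤ b) :
    partialSum el f n ≤ n * b := by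
  refine (List.sum_le_card_nsmul _ b ?_).trans ?_
  · intro y hy
    obtain ⟨x, hx, rfl⟩ := List.mem_map.1 hy
    exact h x (List.mem_of_mem_take hx)
  · rw [List.length_map, List.length_take, smul_eq_mul]
    exact Nat.mul_le_mul_right _ (min_le_left _ _)

theorem partialSum_mono (el : List Element) (f : Element → ℕ) : Monotone (partialSum el f) := by
  refine monotone_nat_of_le_succ fun n => ?_
  rcases lt_or_ge n el.length with h | h
  · rw [partialSum_succ h]; omega
  · rw [partialSum_of_length_le h, partialSum_of_length_le (by omega)]

variable (el : Fin 4 → List Element) (r : ℕ)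

open Classical in
/-- Whether the inner loop is needed. -/
def loopFlag (k : Fin 4) : ℕ := if ∃ x ∈ el k, 5 ≤ x.rank then 1 else 0

theorem loopFlag_le (k : Fin 4) : loopFlag el k ≤ 1 := by unfold loopFlag; split <;> simp

/-- The counters: the scale and the inner loop, and the boundaries between the Roles. -/
abbrev Track (r : ℕ) := Bool ⊕ Fin (r + 1)

/-- Boundary `i` is the sum over the first `i + 1` elements of the list. Boundaries beyond the
length of the list all equal the total, so `Fin.last r` serves as the area of the region for every
`k`. -/
def trackInc (k : Fin 4) (ph : Phase) : Track r → ℕ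
  | .inl false => if ph = .inner then 0 else loopFlag el k
  | .inl true => if ph = .inner then 1 else 0
  | .inr i => partialSum (el k) (fun x => rankInc ph x.rank) (i + 1)

def trackBound (r : ℕ) : ℕ := (r + 1) * 36

def trackCarry (k : Fin 4) (ph : Phase) (i : Track r) : Fin (trackBound r + 1) :=
  Fin.ofNat (trackBound r + 1) (trackInc el r k ph i)

variable {el r}

theorem trackCarry_val (hel : ∀ k, ∀ x ∈ el k, 2 ≤ x.rank ∧ x.rank ≤ 6)
    (k : Fin 4) (ph : Phase) (i : Track r) :
    (trackCarry el r k ph i : ℕ) = trackInc el r k ph i := by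
  simp only [trackCarry, Fin.ofNat]
  apply Nat.mod_eq_of_lt
  have := loopFlag_le el k
  unfold trackBound
  rcases i with (_ | _) | i
  · simp only [trackInc]; split <;> omega
  · simp only [trackInc]; split <;> omega
  · have h1 := partialSum_le (el k) (fun x => rankInc ph x.rank) 36 (i + 1) fun x hx =>
      rankInc_le (hel k x hx).1 (hel k x hx).2 ph
    have h2 : ((i : ℕ) + 1) * 36 ≤ (r + 1) * 36 := Nat.mul_le_mul_right _ (by omega)
    simp only [trackInc]
    omega

theorem loopValue_scale (hel : ∀ k, ∀ x ∈ el k, 2 ≤ x.rank ∧ x.rank ≤ 6)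
    (k : Fin 4) (n : ℕ) :
    loopValue (trackCarry el r) (.inl false) (.inl true) k n (.inl false) =
      loopFlag el k * (n + 1) := by
  induction n with
  | zero => simp [loopValue, bump, trackCarry_val hel, trackInc]
  | succ n ih =>
    rw [loopValue]
    simp only [bump, ih, trackCarry_val hel, trackInc]
    simp
    ring

theorem loopValue_boundary (hel : ∀ k, ∀ x ∈ el k, 2 ≤ x.rank ∧ x.rank ≤ 6)
    (k : Fin 4) (n : ℕ) (i : Fin (r + 1)) :
    loopValue (trackCarry el r) (.inl false) (.inl true) k n (.inr i) =
      partialSum (el k) (fun x => rankArea (n + 1) x.rank) (i + 1) := by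
  induction n with
  | zero => simp [loopValue, bump, trackCarry_val hel, trackInc, rankInc]
  | succ n ih =>
    rw [loopValue]
    simp only [bump, ih, loopValue_scale hel, trackCarry_val hel, trackInc]
    simp only [reduceCtorEq, false_and, if_false, partialSum]
    rw [← List.sum_map_mul_left, ← List.sum_map_add, ← List.sum_map_add]
    congr 1
    apply List.map_congr_left
    intro x hx
    have hx' := List.mem_of_mem_take hx
    rw [rankArea_succ (hel k x hx').1 (hel k x hx').2 (n + 1)]
    -- A quadratic area forces the inner loop to be on; for the other kinds the inner increment is
    -- zero.
    by_cases h5 : 5 ≤ x.rank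
    · have : loopFlag el k = 1 := if_pos ⟨x, hx', h5⟩
      rw [this, one_mul]
    · rw [rankInc_inner_eq_zero (by omega), mul_zero, mul_zero]

end Tracks

/-! ## The final assignment of Roles -/

theorem exists_sorted_list (R : Finset Element) : ∃ L : List Element, L.Nodup ∧
    L.Pairwise (fun x y => x.rank ≤ y.rank) ∧ ∀ x, x ∈ L ↔ x ∈ R := by
  refine ⟨R.toList.mergeSort fun x y => decide (x.rank ≤ y.rank), ?_, ?_, ?_⟩
  · exact (List.mergeSort_perm _ _).nodup_iff.2 R.nodup_toList
  · have := List.pairwise_mergeSort (le := fun x y : Element => decide (x.rank ≤ y.rank))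
      (fun a b c h1 h2 => by simp only [decide_eq_true_eq] at *; omega)
      (fun a b => by simp only [Bool.or_eq_true, decide_eq_true_eq]; omega) R.toList
    simpa using this
  · intro x
    rw [(List.mergeSort_perm _ _).mem_iff, Finset.mem_toList]

theorem sum_testBit (v N : ℕ) (h : v < 2 ^ N) :
    ∑ i : Fin N, (if v.testBit i then 2 ^ (i : ℕ) else 0) = v := by
  have key : ∀ n, ∑ i ∈ Finset.range n, (if v.testBit i then 2 ^ i else 0) = v % 2 ^ n := by
    intro n
    induction n with
    | zero => simp [Nat.mod_one]
    | succ n ih =>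
      rw [Finset.sum_range_succ, ih, Nat.mod_pow_succ, Nat.testBit_eq_decide_div_mod_eq]
      rcases Nat.mod_two_eq_zero_or_one (v / 2 ^ n) with h | h <;> simp [h]
  rw [Fin.sum_univ_eq_sum_range (fun i => if v.testBit i then 2 ^ i else 0), key,
    Nat.mod_eq_of_lt h]

/-- The particles of the chunk, plus those of them that are Double. -/
theorem sum_chunk (a b e N : ℕ) :
    ∑ j : Fin N, (if a ≤ (j : ℕ) ∧ (j : ℕ) < b then if e ≤ (j : ℕ) then 2 else 1 else 0) =
      (min b N - a) + (min b N - max a e) := by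
  rw [Fin.sum_univ_eq_sum_range (fun j => if a ≤ j ∧ j < b then if e ≤ j then 2 else 1 else 0)]
  induction N with
  | zero => simp
  | succ N ih =>
    rw [Finset.sum_range_succ, ih]
    split_ifs <;> omega

theorem Element.card_cell (x : Element) : x.cell.card = (x.rank + 1) / 2 := by
  cases x <;> simp only [Element.cell, Element.rank] <;> omega

theorem regionArea_eq_partialSum {R : Finset Element} {L : List Element} (hnd : L.Nodup)
    (hmem : ∀ x, x ∈ L ↔ x ∈ R) (f : Element → ℕ) {n : ℕ} (hn : L.length ≤ n) :
    ∑ x ∈ R, f x = partialSum L f n := by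
  rw [partialSum_of_length_le hn, ← List.sum_toFinset f hnd]
  congr 1
  ext x
  rw [List.mem_toFinset, hmem]

/-- The Roles are correct if the `i`-th element of a list of `R`, sorted by rank, is the Role of the
particles between the sums of the areas of the first `i` and the first `i + 1` elements. -/
theorem rolesAssigned_of_boundaries {A : RoleAlgorithm} {S : Shape} {k : ℕ} {s : Vertex}
    {R : Finset Element} {N l : ℕ} {q : Fin N → A.Q} {L : List Element} (hnd : L.Nodup)
    (hsort : L.Pairwise fun x y => x.rank ≤ y.rank) (hmem : ∀ x, x ∈ L ↔ x ∈ R)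
    (hsel : S.IsSelection k s R) (hrank : ∀ x ∈ R, 2 ≤ x.rank ∧ x.rank ≤ 6)
    (hN : N ≤ regionArea k s R l)
    (hexc : ∀ y ∈ R, (∀ x ∈ R, x.rank ≤ y.rank) → 3 ≤ y.rank →
      2 * (regionArea k s R l - N) ≤ y.area k s l)
    (hl : l < 2 ^ N)
    (hrole : ∀ (j : Fin N) (i : ℕ) (h : i < L.length), partialSum L (Element.area k s l) i ≤ j →
      (j : ℕ) < partialSum L (Element.area k s l) (i + 1) → A.role (q j) = some L[i])
    (hdouble : ∀ j : Fin N, A.double (q j) = decide (N ≤ (j : ℕ) + (regionArea k s R l - N)))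
    (hdigit : ∀ j : Fin N, A.digit (q j) = l.testBit j) : RolesAssigned A S k s R l q := by
  set c := partialSum L (Element.area k s l) with hc
  have hreg : regionArea k s R l = c L.length :=
    regionArea_eq_partialSum hnd hmem _ le_rfl
  have hmono : Monotone c := partialSum_mono L _
  have hex : ∀ j : Fin N, ∃ (i : ℕ) (h : i < L.length), c i ≤ j ∧ (j : ℕ) < c (i + 1) ∧
      A.role (q j) = some L[i] := by
    intro j
    have hlt : ∃ i, (j : ℕ) < c (i + 1) := by
      refine ⟨L.length, lt_of_lt_of_le (lt_of_lt_of_le j.2 (hreg ▸ hN)) (hmono (Nat.le_succ _))⟩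
    classical
    have h1 := Nat.find_spec hlt
    have h2 : c (Nat.find hlt) ≤ j := by
      rcases hi : Nat.find hlt with _ | i
      · exact Nat.zero_le _
      · exact not_lt.1 (Nat.find_min hlt (hi ▸ Nat.lt_succ_self i))
    have h3 : Nat.find hlt < L.length := by
      by_contra h
      have := hmono (not_lt.1 h)
      have := j.2
      omega
    exact ⟨_, h3, h2, h1, hrole j _ h3 h2 h1⟩
  have hiff : ∀ (j : Fin N) (i : ℕ) (h : i < L.length), A.role (q j) = some L[i] ↔
      c i ≤ j ∧ (j : ℕ) < c (i + 1) := by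
    intro j i h
    refine ⟨fun hr => ?_, fun hr => hrole j i h hr.1 hr.2⟩
    obtain ⟨i', h', h1, h2, h3⟩ := hex j
    rw [hr, Option.some.injEq, hnd.getElem_inj_iff] at h3
    subst h3
    exact ⟨h1, h2⟩
  have hrank_le : ∀ (i i' : ℕ) (h : i < L.length) (h' : i' < L.length), i ≤ i' →
      L[i].rank ≤ L[i'].rank := by
    intro i i' h h' hii
    rcases hii.eq_or_lt with rfl | hlt
    · exact le_rfl
    · exact List.pairwise_iff_getElem.1 hsort i i' h h' hlt
  obtain ⟨σ, hσ, hσ2⟩ := S.exists_edge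
  obtain ⟨y₀, hy₀, hy₀2⟩ := hsel.exists_card_eq hσ
  obtain ⟨i₀, hi₀, rfl⟩ := List.getElem_of_mem ((hmem y₀).2 hy₀)
  obtain ⟨n, hn⟩ : ∃ n, L.length = n + 1 := ⟨L.length - 1, by omega⟩
  have hlast : n < L.length := by omega
  have hlastR : L[n] ∈ R := (hmem _).1 (List.getElem_mem hlast)
  have hmax : ∀ x ∈ R, x.rank ≤ L[n].rank := by
    intro x hx
    obtain ⟨i, hi, rfl⟩ := List.getElem_of_mem ((hmem x).2 hx)
    exact hrank_le _ _ _ _ (by omega)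
  have hlast3 : 3 ≤ L[n].rank := by
    have := hmax _ hy₀
    rw [Element.card_cell, hσ2] at hy₀2
    omega
  have hexc' := hexc _ hlastR hmax hlast3
  have hcn : c L.length = c n + L[n].area k s l := by
    rw [hn, hc, partialSum_succ hlast]
  -- The last chunk has `area - d` particles for the last element, and `2 * d ≤ area` makes this at
  -- least `d`.
  have hdrole : ∀ j : Fin N, A.double (q j) = true → A.role (q j) = some L[n] := by
    intro j hj
    rw [hdouble, decide_eq_true_eq] at hj
    rw [hiff, ← hn]
    have := j.2
    omega
  refine ⟨?_, ?_, ?_, ?_, ?_, ?_, ?_, ?_⟩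
  · simp only [hdigit]
    exact sum_testBit l N hl
  · intro j
    obtain ⟨i, h, -, -, h3⟩ := hex j
    exact ⟨_, (hmem _).1 (List.getElem_mem h), h3⟩
  · intro j₁ j₂ j₃ h12 h23 he
    obtain ⟨i, h, h1, h2, h3⟩ := hex j₁
    rw [h3] at he ⊢
    have h4 := (hiff j₃ i h).1 he.symm
    exact (hiff j₂ i h).2 ⟨h1.trans h12, lt_of_le_of_lt h23 h4.2⟩
  · intro j₁ j₂ h12 x y hx hy
    obtain ⟨i, h, h1, h2, h3⟩ := hex j₁
    obtain ⟨i', h', h1', h2', h3'⟩ := hex j₂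
    rw [h3, Option.some.injEq] at hx
    rw [h3', Option.some.injEq] at hy
    subst hx hy
    apply hrank_le
    by_contra hlt
    have h4 := hmono (show i' + 1 ≤ i by omega)
    have h5 : (j₁ : ℕ) ≤ j₂ := h12
    omega
  · intro j
    rw [hdouble, decide_eq_true_eq]
  · intro x hx
    obtain ⟨i, hi, rfl⟩ := List.getElem_of_mem ((hmem x).2 hx)
    have hd : ∀ j : Fin N, (A.double (q j) = true) ↔ N - (regionArea k s R l - N) ≤ (j : ℕ) := by
      intro j
      rw [hdouble, decide_eq_true_eq]
      omega
    simp only [hiff _ i hi, hd]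
    rw [sum_chunk]
    have hci : c (i + 1) = c i + L[i].area k s l := by
      rw [hc, partialSum_succ hi]
    rcases (show i ≤ n by omega).eq_or_lt with rfl | hin
    · rw [← hn]
      omega
    · have := hmono (show i + 1 ≤ n by omega)
      omega
  · rintro ⟨τ, hτ, hτ3⟩ j hj
    refine ⟨_, hlastR, hdrole j hj, ?_⟩
    obtain ⟨y, hy, hy3⟩ := hsel.exists_card_eq hτ
    have h1 := hmax _ hy
    have h2 := hrank _ hlastR
    rw [Element.card_cell, hτ3] at hy3
    rw [Element.card_cell]
    omega
  · intro htri
    refine ⟨_, hlastR, ?_, hdrole⟩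
    have h1 : L[n].cell.card ≠ 3 := fun h =>
      htri ⟨_, S.elements_cell_mem (hsel.1 _ hlastR), h⟩
    have h2 := hrank _ hlastR
    rw [Element.card_cell] at h1 ⊢
    omega

open Classical in
/-- The index of the first raised flag, or else the number of flags. -/
def firstFlag {n : ℕ} (f : Fin n → Bool) : ℕ :=
  Nat.find (p := fun i => ∀ h : i < n, f ⟨i, h⟩ = true) ⟨n, fun h => absurd h (lt_irrefl n)⟩

theorem firstFlag_eq {n : ℕ} {f : Fin n → Bool} {i : ℕ} (h : ∀ h : i < n, f ⟨i, h⟩ = true)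
    (h' : ∀ i' < i, ∃ h : i' < n, f ⟨i', h⟩ = false) : firstFlag f = i := by
  classical
  unfold firstFlag
  rw [Nat.find_eq_iff]
  refine ⟨h, fun i' hi' hall => ?_⟩
  obtain ⟨h1, h2⟩ := h' i' hi'
  rw [hall h1] at h2
  exact absurd h2 (by simp)

/-- The Role that is stored in a cell. -/
def cellRole (el : Fin 4 → List Element) {r : ℕ} (g : Cell (Track r)) : Option Element :=
  (el g.par)[firstFlag fun i => g.flag (.inr i)]?

/-- Without raised flags the index is `r + 1`, past the end of every list, so Role is Undefined. -/
theorem cellRole_blank {el : Fin 4 → List Element} {r : ℕ} (h : ∀ k, (el k).length ≤ r + 1) :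
    cellRole el (blankCell (Track r)) = none := by
  unfold cellRole
  rw [firstFlag_eq (i := r + 1) (fun h => absurd h (lt_irrefl _)) fun i' hi' => ⟨hi', rfl⟩]
  exact List.getElem?_eq_none (h _)

theorem cellRole_tape {el : Fin 4 → List Element} {r : ℕ} (h : ∀ k, (el k).length ≤ r + 1)
    (f : Element → ℕ) {k : Fin 4} {B : Track r → ℕ}
    (hB : ∀ i, B (.inr i) = partialSum (el k) f (i + 1)) {li : Track r} {N v j i : ℕ}
    (hi : i < (el k).length) (h1 : partialSum (el k) f i ≤ j)
    (h2 : j < partialSum (el k) f (i + 1)) :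
    cellRole el (tape li N k B v j) = some (el k)[i] := by
  unfold cellRole
  have : firstFlag (fun i => (tape li N k B v j).flag (.inr i)) = i := by
    apply firstFlag_eq
    · intro hr
      simp only [tape, hB, decide_eq_true_eq]
      exact h2
    · intro i' hi'
      refine ⟨lt_of_lt_of_le (hi'.trans hi) (h k), ?_⟩
      simp only [tape, hB, decide_eq_false_iff_not, not_lt]
      exact (partialSum_mono _ f (by omega)).trans h1
  rw [this]
  exact List.getElem?_eq_getElem hi

/-- The role assignment algorithm for sorted lists of elements. -/
def roleCounter (el : Fin 4 → List Element) (r : ℕ) (h : ∀ k, (el k).length ≤ r + 1) :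
    RoleAlgorithm :=
  (counter (trackCarry el r) (.inl false) (.inl true) (.inr (Fin.last r))).roleAlgorithm
    (blankCell (Track r)) (fun k => emit (trackCarry el r) k .first) (cellRole el) Cell.double
    Cell.digit (cellRole_blank h)

/-- Bounds the number of sweeps by `N`. With the inner loop on there are at most `1 + n(n + 1)`
sweeps, which the quadratic lower bound on the area absorbs; with it off there are only `1 + n`. -/
theorem sum_rounds_le {h n N : ℕ} (hh : h ≤ 1) (h1 : 3 * n < N) (h2 : h = 1 → 5 * n ^ 2 < N) :
    1 + ∑ q ∈ Finset.range n, (h * (q + 1) + 1) ≤ N := by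
  have hsum : ∑ q ∈ Finset.range n, (h * (q + 1) + 1) ≤ n * (h * n + 1) := by
    have := Finset.sum_le_card_nsmul (Finset.range n) (fun q => h * (q + 1) + 1) (h * n + 1)
      fun q hq => by
        have := Finset.mem_range.1 hq
        have := Nat.mul_le_mul_left h (show q + 1 ≤ n by omega)
        omega
    simpa using this
  rcases Nat.le_one_iff_eq_zero_or_eq_one.1 hh with rfl | rfl
  · omega
  · have := h2 rfl
    nlinarith

end

end Particles

open Particles in
theorem theorem3p5 :
    ∃ C : ℕ, ∀ m : ℕ, ∃ K : ℕ, ∀ S : Particles.Shape, S.size = m →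
      (∀ k s, S.Compatible k s → ∃ R, S.IsSelection k s R) ∧
      ∀ sel : ℕ → Particles.Vertex → Finset Particles.Element,
        (∀ k s, S.Compatible k s → S.IsSelection k s (sel k s)) →
        ∃ A : Particles.RoleAlgorithm,
          ∀ (k : ℕ) (s : Particles.Vertex), S.Compatible k s →
          ∀ N : ℕ, C * m ^ 3 ≤ k * N →
          ∃ l : ℕ, Particles.IsScale k s (sel k s) N l ∧
          ∀ (D : Particles.Directrices k N) (port : Fin k × Fin N → Particles.Ports)
            (active : ℕ → Set (Fin k × Fin N))
            (c : ℕ → Particles.Config (Fin k × Fin N) A.Q A.M),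
            Particles.Fair active →
            c 0 = A.initial D port →
            (∀ t, Particles.Step A.toAlgorithm port (active t) (c t) (c (t + 1))) →
            (∀ t p, (c t).head p = D.pos p ∧ (c t).tail p = none) ∧
            ∃ r : ℕ, r ≤ K * (k * N) ^ 2 ∧ ∀ t, Particles.roundEnd active r ≤ t →
              ∀ j : Fin k, Particles.RolesAssigned A S k s (sel k s) l
                (fun i => (c t).state (j, i)) := by
  refine ⟨2808 * 780 ^ 2, fun m => ⟨2, fun S hS =>
    ⟨fun k s h => S.exists_selection h, fun sel hsel => ?_⟩⟩⟩
  -- The Leaders know `k` but not `s`; one list for each `k` is enough because the shape and `k`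
  -- determine `s`.
  have hlist : ∀ κ : Fin 4, ∃ L : List Element, (∀ x ∈ L, 2 ≤ x.rank ∧ x.rank ≤ 6) ∧
      ∀ s, S.Compatible κ s → L.Nodup ∧ L.Pairwise (fun x y => x.rank ≤ y.rank) ∧
        ∀ x, x ∈ L ↔ x ∈ sel κ s := by
    intro κ
    by_cases h : ∃ s, S.Compatible κ s
    · obtain ⟨s, hs⟩ := h
      obtain ⟨L, h1, h2, h3⟩ := exists_sorted_list (sel κ s)
      refine ⟨L, fun x hx => ?_, fun s' hs' => ?_⟩
      · have := area_eq_rankArea hs ((hsel _ _ hs).1 x ((h3 x).1 hx)) 0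
        exact ⟨this.1, this.2.1⟩
      · rw [← hs.unique hs']
        exact ⟨h1, h2, h3⟩
    · exact ⟨[], by simp, fun s hs => absurd ⟨s, hs⟩ h⟩
  choose el hel1 hel2 using hlist
  set r := ∑ κ, (el κ).length with hr
  have hlen : ∀ κ, (el κ).length ≤ r + 1 := fun κ =>
    (Finset.single_le_sum (f := fun κ => (el κ).length) (fun _ _ => Nat.zero_le _)
      (Finset.mem_univ κ)).trans (Nat.le_succ _)
  refine ⟨roleCounter el r hlen, fun k s hk N hN => ?_⟩
  have hk3 : 1 ≤ k ∧ k ≤ 3 := by rcases hk.kind with h | h | h <;> omega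
  set R := sel k s with hR
  have hRsel : S.IsSelection k s R := hsel k s hk
  have hκ : ((Fin.ofNat 4 k : Fin 4) : ℕ) = k := Nat.mod_eq_of_lt (by omega)
  obtain ⟨hnd, hsort, hmem⟩ := hel2 (Fin.ofNat 4 k) s (by rwa [hκ])
  rw [hκ] at hmem
  set κ : Fin 4 := Fin.ofNat 4 k with hκdef
  have hrank : ∀ x ∈ R, 2 ≤ x.rank ∧ x.rank ≤ 6 := fun x hx => hel1 κ x ((hmem x).2 hx)
  have harea : ∀ q, ∀ x ∈ R, x.area k s (6 * q + 1) = rankArea q x.rank := fun q x hx =>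
    (area_eq_rankArea hk (hRsel.1 x hx) q).2.2
  have hregion : ∀ q, regionArea k s R (6 * q + 1) = ∑ x ∈ R, rankArea q x.rank := fun q =>
    Finset.sum_congr rfl (harea q)
  have hm : 0 < m := by
    have := S.vertices_nonempty.card_pos
    have := S.card_vertices_le
    omega
  have hcard : R.card ≤ 52 * m := hS ▸
    (Finset.card_le_card fun x hx => S.elements_subset (hRsel.1 x hx)).trans S.card_allElements_le
  obtain ⟨y, hy, hy3⟩ : ∃ y ∈ R, 3 ≤ y.rank := by
    obtain ⟨σ, hσ, hσ2⟩ := S.exists_edge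
    obtain ⟨y, hy, hy2⟩ := hRsel.exists_card_eq hσ
    rw [Element.card_cell, hσ2] at hy2
    exact ⟨y, hy, by omega⟩
  have hlow : ∀ q, ∀ x ∈ R, rankArea q x.rank ≤ ∑ x ∈ R, rankArea q x.rank := fun q x hx =>
    Finset.single_le_sum (f := fun x => rankArea q x.rank) (fun _ _ => Nat.zero_le _) hx
  have hlow3 : ∀ q, 3 * (q + 1) ≤ ∑ x ∈ R, rankArea (q + 1) x.rank := fun q =>
    (le_rankArea hy3 (hrank y hy).2 q).trans (hlow _ y hy)
  have hreach : ∃ n, N ≤ ∑ x ∈ R, rankArea (n + 1) x.rank :=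
    ⟨N, le_trans (by omega) (hlow3 N)⟩
  classical
  obtain ⟨n, hn, hmin⟩ : ∃ n, N ≤ ∑ x ∈ R, rankArea (n + 1) x.rank ∧
      ∀ n' < n, ∑ x ∈ R, rankArea (n' + 1) x.rank < N :=
    ⟨Nat.find hreach, Nat.find_spec hreach, fun n' hn' => not_le.1 (Nat.find_min hreach hn')⟩
  have hlarge := scale_large hrank hm hcard hk3.2 hN hn
  -- The scale is not the initial one, so a previous scale with too small a region exists, and the
  -- excess can be compared with the growth since then.
  obtain ⟨p, rfl⟩ : ∃ p, n = p + 1 := ⟨n - 1, by omega⟩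
  have hp := hmin p (Nat.lt_succ_self p)
  have hpN : 3 * (p + 1) < N := lt_of_le_of_lt (hlow3 p) hp
  have hl : 6 * (p + 1) + 7 = 6 * (p + 1 + 1) + 1 := by ring
  refine ⟨6 * (p + 1) + 7, ⟨by omega, by omega, ?_, ?_⟩, ?_⟩
  · rwa [hl, hregion]
  · intro l' h7 hl' hlt
    obtain ⟨n', rfl⟩ : ∃ n', l' = 6 * (n' + 1) + 1 := ⟨l' / 6 - 1, by omega⟩
    rw [hregion]
    exact hmin n' (by omega)
  intro D port active c hfair h0 hstep
  have hN2 : 2 ≤ N := by omega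
  have hVli : ∀ q, loopValue (trackCarry el r) (.inl false) (.inl true) κ q (.inr (Fin.last r)) =
      ∑ x ∈ R, rankArea (q + 1) x.rank := by
    intro q
    rw [loopValue_boundary hel1, regionArea_eq_partialSum hnd hmem (fun x => rankArea (q + 1) x.rank)]
    exact hlen κ
  have hhalt := counter_halts (trackCarry el r) (qi := .inl false) (ji := .inl true)
    (li := .inr (Fin.last r)) (k := κ) (q := p + 1) (by simp) (by simp) hN2
    (by rw [trackCarry_val hel1]; rfl) (by rw [trackCarry_val hel1]; rfl)
    (by
      intro q' hq'
      rw [hVli, loopValue_scale hel1]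
      refine ⟨hmin q' hq', ?_⟩
      have := Nat.mul_le_mul_right (q' + 1) (loopFlag_le el κ)
      omega)
    (by rw [hVli]; exact hn)
  simp only [loopValue_scale hel1] at hhalt
  obtain ⟨hstay, hfinal⟩ := Sweeper.finished _ _ _ hN2 hfair h0 hstep hhalt
  refine ⟨hstay, 2 * (N - 1) * (1 + ∑ q ∈ Finset.range (p + 1), (loopFlag el κ * (q + 1) + 1)) + 1,
    ?_, fun t ht j => ?_⟩
  · have hsum := sum_rounds_le (loopFlag_le el κ) hpN (by
      intro hflag
      have hex : ∃ x ∈ el κ, 5 ≤ x.rank := by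
        by_contra hno
        rw [loopFlag, if_neg hno] at hflag
        omega
      obtain ⟨x, hx, hx5⟩ := hex
      have hxR := (hmem x).1 hx
      exact lt_of_le_of_lt ((le_rankArea_of_five_le hx5 (hrank x hxR).2 p).trans (hlow _ x hxR)) hp)
    have h1 := Nat.mul_le_mul_left (2 * (N - 1)) hsum
    have h2 : N ≤ k * N := Nat.le_mul_of_pos_left N (by omega)
    have h3 : N ^ 2 ≤ (k * N) ^ 2 := Nat.pow_le_pow_left h2 2
    obtain ⟨M, rfl⟩ := Nat.exists_eq_add_of_le' hN2
    have h4 : M + 2 - 1 = M + 1 := rfl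
    rw [h4] at h1 ⊢
    nlinarith
  · have hst := fun i => hfinal t ht j i
    refine rolesAssigned_of_boundaries hnd hsort hmem hRsel hrank ?_ ?_ ?_ ?_ ?_ ?_
    · rwa [hl, hregion]
    · intro y hy hmax hy3
      rw [hl, hregion, harea _ y hy]
      exact two_mul_excess_le hrank (by omega) hp hy hmax hy3
    -- The scale has at most `N` binary digits, because `3 * (p + 1) < N` and `p` is large.
    · obtain ⟨M, rfl⟩ := Nat.exists_eq_add_of_le' hN2
      have := Nat.lt_two_pow_self (n := M)
      rw [pow_add]
      omega
    · intro i a ha h1 h2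
      rw [hst]
      have hps : ∀ a, partialSum (el κ) (fun x => rankArea (p + 1 + 1) x.rank) a =
          partialSum (el κ) (Element.area k s (6 * (p + 1) + 7)) a := by
        intro a
        unfold partialSum
        congr 1
        apply List.map_congr_left
        intro x hx
        rw [hl, harea _ x ((hmem x).1 (List.mem_of_mem_take hx))]
      rw [← hps] at h1 h2
      change cellRole el (Sweeper.trim _ N _ (i : ℕ)) = _
      rw [Sweeper.trim, if_pos i.2]
      exact cellRole_tape hlen _ (fun b => loopValue_boundary hel1 κ (p + 1) b) ha h1 h2
    · intro i
      rw [hst]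
      change Cell.double (Sweeper.trim _ N _ (i : ℕ)) = _
      rw [Sweeper.trim, if_pos i.2, hl, hregion, ← hVli]
      rfl
    · intro i
      rw [hst]
      change Cell.digit (Sweeper.trim _ N _ (i : ℕ)) = _
      rw [Sweeper.trim, if_pos i.2]
      rfl
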